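/- Write $\zeta^*(s)=\pi^{-s/2}\Gamma(s/2)\zeta(s)$ for the completed Riemann zeta function. Let $f:\mathcal H\to\mathbb C$ be a locally integrable function on the upper half plane $\mathcal H=\{z=x+iy:\ y>0\}$ that is invariant under $SL_2(\mathbb Z)$, and let $a_0(y)=\int_0^1 f(x+iy)\,dx$ be its constant Fourier term. Suppose that $f$ has polynomial growth at the cusp: there are $l\ge 0$, $c_i,\alpha_i\in\mathbb C$ and $n_i\in\mathbb Z_{\ge0}$ ($1\le i\le l$) such that, with $$\varphi(y)=\sum_{i=1}^{l}\frac{c_i}{n_i!}\,y^{\alpha_i}\log^{n_i}y ,$$ one has $f(x+iy)=\varphi(y)+o(y^{-N})$ as $y\to\infty$, uniformly in $x$, for every $N>0$. Then the integral defining the Rankin–Selberg transform $$R^*(f,s)=\zeta^*(2s)\int_0^\infty y^{s-2}\bigl(a_0(y)-\varphi(y)\bigr)\,dy$$ converges absolutely for $\operatorname{Re}(s)$ sufficiently large, and $R^*(f,s)$ continues to a meromorphic function on $\mathbb C$ of the form $$R^*(f,s)=\sum_{i=1}^{l}c_i\left(\frac{\zeta^*(2s)}{(1-s-\alpha_i)^{n_i+1}}+\frac{\zeta^*(2s-1)}{(s-\alpha_i)^{n_i+1}}\right)+\frac{h(s)}{s(s-1)},$$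 where $h$ is an entire function of $s$. -/

import Mathlib

open scoped UpperHalfPlane MatrixGroups

noncomputable section

/-- The constant Fourier term `a₀(y) = ∫₀¹ f(x + iy) dx` of a function on the upper half plane
(used for `y > 0`, where `UpperHalfPlane.ofComplex (x + iy)` is the point `x + iy`). -/
def constantTerm (f : ℍ → ℂ) (y : ℝ) : ℂ :=
  ∫ x in (0 : ℝ)..1, f (UpperHalfPlane.ofComplex (x + y * Complex.I))

/-- The growing part `φ(y) = ∑ i, (c i / (n i)!) * y ^ (α i) * (log y) ^ (n i)`. -/
def growingPart {l : ℕ} (c α : Fin l → ℂ) (n : Fin l → ℕ) (y : ℝ) : ℂ :=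
  ∑ i, c i / ((n i).factorial : ℂ) * (y : ℂ) ^ α i * (Real.log y : ℂ) ^ n i

/-- The integrand `y ^ (s - 2) * (a₀(y) - φ(y))` of the Rankin-Selberg transform. -/
def rankinSelbergIntegrand (f : ℍ → ℂ) (φ : ℝ → ℂ) (s : ℂ) (y : ℝ) : ℂ :=
  (y : ℂ) ^ (s - 2) * (constantTerm f y - φ y)

/-- The Rankin-Selberg transform `R*(f, s) = ζ*(2s) ∫₀^∞ y ^ (s - 2) (a₀(y) - φ(y)) dy`, where
`ζ*(s) = π ^ (-s/2) Γ(s/2) ζ(s)` is Mathlib's `completedRiemannZeta`. -/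
def rankinSelbergTransform (f : ℍ → ℂ) (φ : ℝ → ℂ) (s : ℂ) : ℂ :=
  completedRiemannZeta (2 * s) * ∫ y in Set.Ioi (0 : ℝ), rankinSelbergIntegrand f φ s y

end

namespace RankinSelberg

open MeasureTheory Set Filter Topology
open scoped Real UpperHalfPlane MatrixGroups ENNReal Modular

/-! The continuation is Riemann's theta-function proof for ζ, carried out on the modular surface.
Put Q(m, n) = |mz + n|²/y, let Θ(z, t) be the sum of exp(-πtQ) over nonzero (m, n), and let θ be
`thetaTail`. Poisson summation gives 1 + Θ(z, 1/t) = t(1 + Θ(z, t)). For decaying f, the integral of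
f(1 + Θ) over 𝒟 inherits this equation, so its Mellin transform continues with at most simple poles
at 0 and 1. Unfolding identifies half of that transform with R*(f, s).

When f grows the integral may diverge, and it is regularised: for y > 1, φ(y) times the constant
Fourier term of 1 + Θ in x is subtracted. That term, 1 + 2θ(t/y) + 2√(y/t)θ(ty), satisfies the same
functional equation, hence so does the regularised integral (`regularizedTheta_inv`). What φ still
multiplies is `nonconstTheta`, which decays faster than any power of y
(`exists_abs_nonconstTheta_le`). The theory of `WeakFEPair` then supplies the entire part and the
poles (`thetaPair`).

For z in 𝒟 only the translates with bottom row (0, ±1) can have height above 1, so unfolding the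
truncated f stays explicit (`integral_fd_eq_integral_strip`). For Re s large, `half_Λ_eq` gives
Λ(s)/2 as ζ*(2s) times the Mellin integral of a₀ - φ·1_{y>1}, minus ζ*(2s-1) times the integral of
φ(y)y^(-1-s) over y > 1. Evaluating the integrals of φ over (0, 1] and (1, ∞) produces the explicit
terms of the theorem. -/

/-- A Gaussian exponential is dominated by every negative power. -/
lemma exists_exp_neg_le_rpow {a : ℝ} (ha : 0 < a) :
    ∃ C, 0 < C ∧ ∀ x, 0 < x → Real.exp (-x) ≤ C * x ^ (-a) := by
  refine ⟨a ^ a, by positivity, fun x hx ↦ ?_⟩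
  have h : x ^ a ≤ a ^ a * Real.exp x := by
    calc x ^ a = a ^ a * (x / a) ^ a := by
          rw [← Real.mul_rpow ha.le (by positivity)]; congr 1; field_simp
      _ ≤ a ^ a * (Real.exp (x / a)) ^ a := by
          gcongr; linarith [Real.add_one_le_exp (x / a)]
      _ = a ^ a * Real.exp x := by
          rw [← Real.exp_mul]; congr 2; field_simp
  rw [Real.exp_neg, Real.rpow_neg hx.le, ← div_eq_mul_inv, le_div_iff₀ (by positivity),
    inv_mul_le_iff₀ (by positivity)]
  linarith

/-! ### Jacobi's theta function and its Mellin transform -/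

/-- The sum `∑_{k ≥ 1} exp (-π k² u)`, half of Jacobi's theta function without its constant term. -/
noncomputable def thetaTail (u : ℝ) : ℝ := ∑' k : ℕ, Real.exp (-π * ((k : ℝ) + 1) ^ 2 * u)

lemma summable_thetaTail {u : ℝ} (hu : 0 < u) :
    Summable fun k : ℕ ↦ Real.exp (-π * ((k : ℝ) + 1) ^ 2 * u) := by
  have := Real.summable_exp_nat_mul_of_ge (c := -(π * u)) (by have := Real.pi_pos; nlinarith [mul_pos Real.pi_pos hu])
    (f := fun k : ℕ ↦ ((k : ℝ) + 1) ^ 2) (fun k ↦ by nlinarith [(Nat.cast_nonneg k : (0:ℝ) ≤ k)])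
  refine this.congr fun k ↦ ?_
  congr 1; ring

lemma thetaTail_nonneg (u : ℝ) : 0 ≤ thetaTail u := tsum_nonneg fun _ ↦ (Real.exp_pos _).le

/-- Sums of measurable functions with values in [0, ∞] are measurable without any summability, and
`toReal` sends a divergent sum to 0, the default value of `tsum` in ℝ. -/
lemma measurable_tsum_exp {ι X : Type*} [Countable ι] [MeasurableSpace X] {g : ι → X → ℝ}
    (hg : ∀ i, Measurable (g i)) : Measurable fun x ↦ ∑' i, Real.exp (g i x) := by
  have : (fun x ↦ ∑' i, Real.exp (g i x)) =
      fun x ↦ (∑' i, ENNReal.ofReal (Real.exp (g i x))).toReal := by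
    funext x
    rw [ENNReal.tsum_toReal_eq (fun _ ↦ ENNReal.ofReal_ne_top)]
    exact tsum_congr fun i ↦ (ENNReal.toReal_ofReal (Real.exp_pos _).le).symm
  rw [this]
  exact ENNReal.measurable_toReal.comp (Measurable.tsum fun i ↦ (hg i).exp.ennreal_ofReal)

lemma measurable_thetaTail : Measurable thetaTail := measurable_tsum_exp fun k ↦ by fun_prop

/-- `thetaTail` is dominated by every power `u ^ (-a)` with `a > 1/2`. -/
lemma exists_thetaTail_le {a : ℝ} (ha : 1 / 2 < a) :
    ∃ C, 0 < C ∧ ∀ u, 0 < u → thetaTail u ≤ C * u ^ (-a) := by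
  obtain ⟨C, hC, h⟩ := exists_exp_neg_le_rpow (a := a) (by linarith)
  have hs : Summable fun k : ℕ ↦ (π * ((k : ℝ) + 1) ^ 2) ^ (-a) := by
    have h1 : Summable fun k : ℕ ↦ ((k + 1 : ℕ) : ℝ) ^ (-(2 * a)) :=
      (summable_nat_add_iff 1).mpr (Real.summable_nat_rpow.mpr (by linarith))
    refine (h1.mul_left (π ^ (-a))).congr fun k ↦ ?_
    rw [Real.mul_rpow Real.pi_pos.le (by positivity), ← Real.rpow_natCast, ← Real.rpow_mul (by positivity)]
    push_cast; congr 2; ring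
  refine ⟨C * ∑' k : ℕ, (π * ((k : ℝ) + 1) ^ 2) ^ (-a), mul_pos hC ?_, fun u hu ↦ ?_⟩
  · exact hs.tsum_pos (fun _ ↦ by positivity) 0 (by positivity)
  · rw [thetaTail, mul_assoc, ← tsum_mul_right, ← tsum_mul_left]
    refine (summable_thetaTail hu).tsum_le_tsum (fun k ↦ ?_) ((hs.mul_right _).mul_left _)
    rw [← Real.mul_rpow (by positivity) hu.le]
    have := h (π * ((k : ℝ) + 1) ^ 2 * u) (by positivity)
    rwa [← neg_mul, ← neg_mul] at this

lemma hasSum_int_exp_neg_sq {u : ℝ} (hu : 0 < u) :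
    HasSum (fun n : ℤ ↦ Real.exp (-π * u * (n : ℝ) ^ 2)) (1 + 2 * thetaTail u) := by
  have h1 : HasSum (fun n : ℕ ↦ Real.exp (-π * u * (((n : ℕ) : ℤ) : ℝ) ^ 2)) (1 + thetaTail u) := by
    have h : HasSum _ (thetaTail u) := (summable_thetaTail hu).hasSum
    have h' : HasSum (fun n : ℕ ↦ Real.exp (-π * u * ((((n + 1) : ℕ) : ℤ) : ℝ) ^ 2)) (thetaTail u) := by
      convert h using 3 with k; push_cast; ring
    have := (hasSum_nat_add_iff (f := fun n : ℕ ↦ Real.exp (-π * u * (((n : ℕ) : ℤ) : ℝ) ^ 2)) 1).mp h'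
    simpa [add_comm] using this
  have := HasSum.of_nat_of_neg (f := fun n : ℤ ↦ Real.exp (-π * u * (n : ℝ) ^ 2)) h1 (by simpa using h1)
  have h0 : Real.exp (-π * u * ((0 : ℤ) : ℝ) ^ 2) = 1 := by simp
  rw [h0] at this
  have h2 : 1 + thetaTail u + (1 + thetaTail u) - 1 = 1 + 2 * thetaTail u := by ring
  rwa [h2] at this

/-- Jacobi's functional equation. -/
lemma thetaTail_inv {u : ℝ} (hu : 0 < u) :
    1 + 2 * thetaTail u⁻¹ = √u * (1 + 2 * thetaTail u) := by
  have h := Real.tsum_exp_neg_mul_int_sq (inv_pos.mpr hu)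
  rw [(hasSum_int_exp_neg_sq (inv_pos.mpr hu)).tsum_eq] at h
  have h2 := (hasSum_int_exp_neg_sq hu).tsum_eq
  rw [h, ← h2, Real.inv_rpow hu.le, ← Real.sqrt_eq_rpow, one_div, inv_inv, div_inv_eq_mul]

/-- Termwise integration: exp(-πk²t) contributes π^(-s) Γ(s) k^(-2s). -/
lemma hasMellin_thetaTail {s : ℂ} (hs : 1 / 2 < s.re) :
    HasMellin (fun t ↦ (thetaTail t : ℂ)) s (completedRiemannZeta (2 * s)) := by
  have hs2 : 1 < (2 * s).re := by simp; linarith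
  have hmeas : LocallyIntegrableOn (fun t ↦ (thetaTail t : ℂ)) (Ioi 0) := by
    rw [locallyIntegrableOn_iff isOpen_Ioi.isLocallyClosed]
    intro k hk hkc
    obtain ⟨C, hC, h⟩ := exists_thetaTail_le (a := 1) (by norm_num)
    have hc : IntegrableOn (fun u : ℝ ↦ C * u ^ (-1 : ℝ)) k := by
      refine ContinuousOn.integrableOn_compact hkc (ContinuousOn.mul continuousOn_const ?_)
      exact fun u hu ↦ (Real.continuousAt_rpow_const _ _ (Or.inl (hk hu).ne')).continuousWithinAt
    refine hc.mono' (Complex.measurable_ofReal.comp measurable_thetaTail).aestronglyMeasurable ?_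
    refine (ae_restrict_iff' hkc.measurableSet).mpr (Eventually.of_forall fun u hu ↦ ?_)
    rw [Complex.norm_real, Real.norm_of_nonneg (thetaTail_nonneg _)]
    exact h u (hk hu)
  refine ⟨?_, ?_⟩
  · obtain ⟨a, ha, has⟩ := exists_between hs
    obtain ⟨C, hC, h⟩ := exists_thetaTail_le (a := s.re + 1) (by linarith)
    obtain ⟨C', hC', h'⟩ := exists_thetaTail_le (a := a) (by linarith)
    refine mellinConvergent_of_isBigO_rpow (a := s.re + 1) (b := a) hmeas ?_ (by linarith) ?_ has
    · refine Asymptotics.IsBigO.of_bound C ?_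
      filter_upwards [eventually_gt_atTop 0] with u hu
      rw [Complex.norm_real, Real.norm_of_nonneg (thetaTail_nonneg _), Real.norm_of_nonneg (by positivity)]
      exact h u hu
    · refine Asymptotics.IsBigO.of_bound C' ?_
      filter_upwards [self_mem_nhdsWithin] with u hu
      have hu : 0 < u := hu
      rw [Complex.norm_real, Real.norm_of_nonneg (thetaTail_nonneg _), Real.norm_of_nonneg (by positivity)]
      exact h' u hu
  · have := hasSum_mellin_pi_mul_sq (ι := ℕ) (a := fun _ ↦ 1) (r := fun k ↦ (k : ℝ) + 1)
      (F := fun t ↦ (thetaTail t : ℂ)) (s := 2 * s) (by linarith) ?_ ?_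
    · rw [mul_div_cancel_left₀ _ two_ne_zero] at this
      rw [← this.tsum_eq, completedZeta_eq_tsum_of_one_lt_re hs2, Complex.Gammaℝ_def, ← tsum_mul_left]
      have hs1 : Summable fun n : ℕ ↦ (π : ℂ) ^ (-(2 * s) / 2) * Complex.Gamma (2 * s / 2) * (1 / (n : ℂ) ^ (2 * s)) :=
        (Complex.summable_one_div_nat_cpow.mpr hs2).mul_left _
      -- The zeta series is indexed from n = 0, where its term vanishes; dropping it matches the
      -- shift k + 1 in `thetaTail`.
      rw [hs1.tsum_eq_zero_add]
      have h0 : (2 * s) ≠ 0 := fun h ↦ by rw [h] at hs2; norm_num at hs2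
      rw [Nat.cast_zero, Complex.zero_cpow h0, div_zero, mul_zero, zero_add]
      refine tsum_congr fun k ↦ ?_
      rw [abs_of_pos (by positivity)]
      push_cast
      ring
    · intro t ht
      have h : HasSum _ (thetaTail t) := (summable_thetaTail ht).hasSum
      have h' := Complex.hasSum_ofReal.mpr h
      convert h' using 2 with k
      rw [if_neg (by positivity), one_mul]
    · have h1 : Summable fun k : ℕ ↦ 1 / ((k + 1 : ℕ) : ℝ) ^ (2 * s).re :=
        (summable_nat_add_iff 1).mpr (Real.summable_one_div_nat_rpow.mpr hs2)
      refine h1.congr fun k ↦ ?_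
      rw [abs_of_pos (by positivity)]
      simp

/-! ### The lattice theta series and its bounds -/

/-- The quadratic form `|m z + n|² / Im z` on pairs of integers `x = (m, n)`. -/
noncomputable def latticeForm (z : ℍ) (x : Fin 2 → ℤ) : ℝ :=
  ((x 0 * z.re + x 1) ^ 2 + (x 0 * z.im) ^ 2) / z.im

/-- The theta series of `latticeForm z` without its constant term. -/
noncomputable def latticeTheta (z : ℍ) (t : ℝ) : ℝ :=
  ∑' x : {x : Fin 2 → ℤ // x ≠ 0}, Real.exp (-π * t * latticeForm z x)

lemma latticeTheta_nonneg (z : ℍ) (t : ℝ) : 0 ≤ latticeTheta z t :=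
  tsum_nonneg fun _ ↦ (Real.exp_pos _).le

lemma measurable_latticeForm (x : Fin 2 → ℤ) : Measurable fun z ↦ latticeForm z x := by
  have h1 : Measurable fun z : ℍ ↦ z.re := Complex.measurable_re.comp UpperHalfPlane.measurable_coe
  have h2 : Measurable fun z : ℍ ↦ z.im := Complex.measurable_im.comp UpperHalfPlane.measurable_coe
  unfold latticeForm
  fun_prop

lemma measurable_latticeTheta : Measurable fun p : ℍ × ℝ ↦ latticeTheta p.1 p.2 :=
  measurable_tsum_exp fun x ↦
    (measurable_const.mul measurable_snd).mul ((measurable_latticeForm x).comp measurable_fst)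

lemma norm_eq_max_abs (x : Fin 2 → ℤ) : ‖x‖ = max |(x 0 : ℝ)| |(x 1 : ℝ)| := by
  rw [EisensteinSeries.norm_eq_max_natAbs]; simp

lemma latticeForm_mul_im (z : ℍ) (x : Fin 2 → ℤ) :
    latticeForm z x * z.im = (x 0 * z.re + x 1) ^ 2 + (x 0 * z.im) ^ 2 :=
  div_mul_cancel₀ _ z.im_pos.ne'

lemma latticeForm_eq_norm_sq (z : ℍ) (x : Fin 2 → ℤ) :
    latticeForm z x = ‖(x 0 : ℂ) * z + x 1‖ ^ 2 / z.im := by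
  rw [latticeForm, ← Complex.normSq_eq_norm_sq, Complex.normSq_apply]
  simp; ring

lemma exists_norm_sq_le_latticeForm (z : ℍ) :
    ∃ c, 0 < c ∧ ∀ x, c * ‖x‖ ^ 2 ≤ latticeForm z x := by
  refine ⟨EisensteinSeries.r z ^ 2 / z.im, div_pos (pow_pos (EisensteinSeries.r_pos z) 2) z.im_pos, fun x ↦ ?_⟩
  rcases eq_or_ne x 0 with rfl | hx
  · simp [latticeForm]
  · rw [latticeForm_eq_norm_sq, div_mul_eq_mul_div, ← mul_pow]
    have := EisensteinSeries.r_mul_max_le z hx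
    have h0 : 0 ≤ EisensteinSeries.r z * ‖x‖ := mul_nonneg (EisensteinSeries.r_pos z).le (norm_nonneg _)
    have := z.im_pos
    gcongr

lemma latticeForm_pos (z : ℍ) {x : Fin 2 → ℤ} (hx : x ≠ 0) : 0 < latticeForm z x := by
  obtain ⟨c, hc, h⟩ := exists_norm_sq_le_latticeForm z
  exact lt_of_lt_of_le (by have := norm_pos_iff.mpr hx; positivity) (h x)

/-- Expand Qy = m²|z|² + 2mnx + n² and use |z| ≥ 1, |x| ≤ 1/2 on 𝒟. -/
lemma quadratic_le_latticeForm_mul_im {z : ℍ} (hz : z ∈ ModularGroup.fd) (x : Fin 2 → ℤ) :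
    |(x 0 : ℝ)| ^ 2 - |(x 0 : ℝ)| * |(x 1 : ℝ)| + |(x 1 : ℝ)| ^ 2 ≤ latticeForm z x * z.im := by
  rw [latticeForm_mul_im]
  have h1 : 1 ≤ z.re ^ 2 + z.im ^ 2 := by
    have := hz.1
    rw [Complex.normSq_apply] at this
    simpa [sq] using this
  have h2 : |z.re| ≤ 1 / 2 := hz.2
  have h3 : -(|(x 0 : ℝ)| * |(x 1 : ℝ)|) ≤ 2 * (x 0 * x 1 * z.re) := by
    have := neg_abs_le ((x 0 : ℝ) * x 1 * z.re)
    rw [abs_mul, abs_mul] at this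
    nlinarith [mul_nonneg (abs_nonneg (x 0 : ℝ)) (abs_nonneg (x 1 : ℝ))]
  rw [sq_abs, sq_abs]
  nlinarith [sq_nonneg (x 0 : ℝ)]

/-- The constant 3/4 is the minimum of 1 - u + u². -/
lemma norm_sq_le_latticeForm_mul_im {z : ℍ} (hz : z ∈ ModularGroup.fd) (x : Fin 2 → ℤ) :
    3 / 4 * ‖x‖ ^ 2 ≤ latticeForm z x * z.im := by
  refine le_trans ?_ (quadratic_le_latticeForm_mul_im hz x)
  rw [norm_eq_max_abs]
  rcases max_cases |(x 0 : ℝ)| |(x 1 : ℝ)| with ⟨h, _⟩ | ⟨h, _⟩ <;> rw [h]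
  · nlinarith [sq_nonneg (|(x 0 : ℝ)| / 2 - |(x 1 : ℝ)|)]
  · nlinarith [sq_nonneg (|(x 1 : ℝ)| / 2 - |(x 0 : ℝ)|)]

/-- The constant c stays a parameter so that the bound serves both a fixed z and all of 𝒟, where c =
3/(4y). -/
lemma exists_exp_latticeForm_le {a : ℝ} (ha : 0 < a) :
    ∃ C, 0 < C ∧ ∀ (z : ℍ) (c : ℝ), 0 < c → (∀ x, c * ‖x‖ ^ 2 ≤ latticeForm z x) →
      ∀ t, 0 < t → ∀ x : Fin 2 → ℤ, x ≠ 0 →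
      Real.exp (-π * t * latticeForm z x) ≤ C * (c * t) ^ (-a) * ‖x‖ ^ (-(2 * a)) := by
  obtain ⟨C, hC, h⟩ := exists_exp_neg_le_rpow ha
  refine ⟨C * π ^ (-a), by positivity, fun z c hc hcx t ht x hx ↦ ?_⟩
  have hn := norm_pos_iff.mpr hx
  calc Real.exp (-π * t * latticeForm z x) ≤ Real.exp (-(π * (c * t) * ‖x‖ ^ 2)) := by
        gcongr
        have := mul_le_mul_of_nonneg_left (hcx x) (mul_pos Real.pi_pos ht).le
        linarith
    _ ≤ C * (π * (c * t) * ‖x‖ ^ 2) ^ (-a) := h _ (by positivity)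
    _ = _ := by
        rw [Real.mul_rpow (by positivity) (by positivity), Real.mul_rpow (by positivity) (by positivity),
          ← Real.rpow_natCast, ← Real.rpow_mul hn.le]
        push_cast
        rw [show (2 : ℝ) * -a = -(2 * a) by ring]
        ring

lemma summable_exp_latticeForm (z : ℍ) {t : ℝ} (ht : 0 < t) :
    Summable fun x : Fin 2 → ℤ ↦ Real.exp (-π * t * latticeForm z x) := by
  obtain ⟨C, hC, h⟩ := exists_exp_latticeForm_le (a := 2) (by norm_num)
  obtain ⟨c, hc, hcx⟩ := exists_norm_sq_le_latticeForm z
  have hs := EisensteinSeries.summable_one_div_norm_rpow (k := 2 * 2) (by norm_num)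
  -- The indicator of 0 majorises the term of the zero vector, where the power `0 ^ (-4)` is 0 by
  -- convention.
  refine ((hs.mul_left (C * (c * t) ^ (-2 : ℝ))).add (summable_of_ne_finset_zero (f := fun x : Fin 2 → ℤ ↦ if x = 0 then 1 else 0) (s := {0}) ?_)).of_nonneg_of_le
    (fun _ ↦ (Real.exp_pos _).le) (fun x ↦ ?_)
  · intro b hb; simpa using hb
  · by_cases hx : x = 0
    · subst hx
      simp only [if_true, latticeForm]
      have : 0 ≤ C * (c * t) ^ (-2 : ℝ) * ‖(0 : Fin 2 → ℤ)‖ ^ (-(2 * 2) : ℝ) := by positivity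
      simp at this ⊢
    · rw [if_neg hx, add_zero]
      exact h z c hc hcx t ht x hx

/-- On the standard fundamental domain, the theta series is dominated by `(y / t) ^ a`, `a > 1`. -/
lemma exists_latticeTheta_le {a : ℝ} (ha : 1 < a) :
    ∃ C, 0 < C ∧ ∀ z ∈ ModularGroup.fd, ∀ t, 0 < t →
      latticeTheta z t ≤ C * z.im ^ a * t ^ (-a) := by
  obtain ⟨C, hC, h⟩ := exists_exp_latticeForm_le (a := a) (by linarith)
  have hs : Summable fun x : {x : Fin 2 → ℤ // x ≠ 0} ↦ ‖x.1‖ ^ (-(2 * a)) :=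
    (EisensteinSeries.summable_one_div_norm_rpow (k := 2 * a) (by linarith)).subtype _
  refine ⟨C * (3 / 4) ^ (-a) * ∑' x : {x : Fin 2 → ℤ // x ≠ 0}, ‖x.1‖ ^ (-(2 * a)),
    mul_pos (by positivity) ?_, fun z hz t ht ↦ ?_⟩
  · have h1 : (fun _ ↦ 1 : Fin 2 → ℤ) ≠ 0 := fun h ↦ by simpa using congrFun h 0
    refine hs.tsum_pos (fun _ ↦ by positivity) ⟨_, h1⟩ ?_
    have := norm_pos_iff.mpr h1
    positivity
  · have hy := z.im_pos
    have hc x : 3 / 4 / z.im * ‖x‖ ^ 2 ≤ latticeForm z x := by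
      rw [div_mul_eq_mul_div, div_le_iff₀ hy]
      exact norm_sq_le_latticeForm_mul_im hz x
    have : C * (3 / 4) ^ (-a) * (∑' x : {x : Fin 2 → ℤ // x ≠ 0}, ‖x.1‖ ^ (-(2 * a))) * z.im ^ a * t ^ (-a) =
        ∑' x : {x : Fin 2 → ℤ // x ≠ 0}, C * (3 / 4 / z.im * t) ^ (-a) * ‖x.1‖ ^ (-(2 * a)) := by
      rw [tsum_mul_left, Real.mul_rpow (by positivity) ht.le, Real.div_rpow (by positivity) hy.le,
        Real.rpow_neg hy.le, div_inv_eq_mul]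
      ring
    rw [this]
    exact ((summable_exp_latticeForm z ht).subtype _).tsum_le_tsum
      (fun x ↦ h z _ (by positivity) hc t ht x x.2) (hs.mul_left _)

lemma hasSum_exp_latticeForm (z : ℍ) {t : ℝ} (ht : 0 < t) :
    HasSum (fun x : Fin 2 → ℤ ↦ Real.exp (-π * t * latticeForm z x)) (1 + latticeTheta z t) := by
  have h := ((summable_exp_latticeForm z ht).subtype {x | x ≠ 0}).hasSum
  have h0 : HasSum (fun x : ({0} : Set (Fin 2 → ℤ)) ↦ Real.exp (-π * t * latticeForm z x)) 1 := by
    convert hasSum_unique (fun x : ({0} : Set (Fin 2 → ℤ)) ↦ Real.exp (-π * t * latticeForm z x)) using 1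
    simp [latticeForm]
  have := HasSum.add_compl (f := fun x : Fin 2 → ℤ ↦ Real.exp (-π * t * latticeForm z x)) (s := {0}) h0 h
  exact this

/-! ### Poisson summation and the functional equation -/

/-- The terms of the theta series after Poisson summation in the second variable. -/
noncomputable def poissonTerm (z : ℍ) (t : ℝ) (p : ℤ × ℤ) : ℂ :=
  ((Real.exp (-π * (t * z.im) * (p.1 : ℝ) ^ 2) * Real.exp (-π * (z.im / t) * (p.2 : ℝ) ^ 2) : ℝ) : ℂ) *
    Complex.exp (((-2 * π * p.1 * p.2 * z.re : ℝ) : ℂ) * Complex.I)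

lemma norm_poissonTerm (z : ℍ) (t : ℝ) (p : ℤ × ℤ) :
    ‖poissonTerm z t p‖ =
      Real.exp (-π * (t * z.im) * (p.1 : ℝ) ^ 2) * Real.exp (-π * (z.im / t) * (p.2 : ℝ) ^ 2) := by
  rw [poissonTerm, norm_mul, Complex.norm_exp_ofReal_mul_I, mul_one, Complex.norm_real,
    Real.norm_of_nonneg (by positivity)]

lemma summable_poissonTerm (z : ℍ) {t : ℝ} (ht : 0 < t) : Summable (poissonTerm z t) := by
  refine Summable.of_norm ?_
  simp_rw [norm_poissonTerm]
  exact (hasSum_int_exp_neg_sq (mul_pos ht z.im_pos)).summable.mul_of_nonneg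
    (hasSum_int_exp_neg_sq (div_pos z.im_pos ht)).summable (fun _ ↦ (Real.exp_pos _).le)
    (fun _ ↦ (Real.exp_pos _).le)

/-- In this form t → 1/t merely exchanges the two summation variables, which is the source of the
functional equation. -/
lemma poissonTerm_inv (z : ℍ) (t : ℝ) (p : ℤ × ℤ) :
    poissonTerm z t⁻¹ p = poissonTerm z t p.swap := by
  simp only [poissonTerm, Prod.fst_swap, Prod.snd_swap, div_inv_eq_mul]
  rw [mul_comm (Real.exp _), mul_comm t⁻¹, ← div_eq_mul_inv, mul_comm z.im t]
  congr 4
  ring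

lemma tsum_exp_latticeForm_row (z : ℍ) {t : ℝ} (ht : 0 < t) (m : ℤ) :
    ∑' n : ℤ, ((Real.exp (-π * t * latticeForm z ![m, n]) : ℝ) : ℂ) =
      √(z.im / t) * ∑' k : ℤ, poissonTerm z t (m, k) := by
  have hy := z.im_pos
  have hyt : 0 < z.im / t := div_pos hy ht
  -- The row m is a Gaussian in n shifted by mx; the imaginary parameter encodes the shift, which
  -- becomes the phase exp(-2πimkx) on the dual side.
  have h := Complex.tsum_exp_neg_quadratic (a := ((z.im / t : ℝ) : ℂ)) (by simpa using hyt)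
    (-Complex.I * (m * z.re))
  have hr : ((z.im / t : ℝ) : ℂ) ^ (1 / 2 : ℂ) = ((√(z.im / t) : ℝ) : ℂ) := by
    rw [Real.sqrt_eq_rpow, Complex.ofReal_cpow hyt.le]; norm_num
  rw [hr] at h
  have hne : ((√(z.im / t) : ℝ) : ℂ) ≠ 0 := by
    exact_mod_cast (Real.sqrt_pos.mpr hyt).ne'
  have h1 k : poissonTerm z t (m, k) = ((Real.exp (-π * (t * z.im) * (m : ℝ) ^ 2) : ℝ) : ℂ) *
      Complex.exp (-π * ((z.im / t : ℝ) : ℂ) * k ^ 2 + 2 * π * (-Complex.I * (m * z.re)) * k) := by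
    rw [poissonTerm]
    push_cast
    rw [mul_assoc, ← Complex.exp_add]
    congr 2
    ring
  have h2 (n : ℤ) : ((Real.exp (-π * t * latticeForm z ![m, n]) : ℝ) : ℂ) =
      ((Real.exp (-π * (t * z.im) * (m : ℝ) ^ 2) : ℝ) : ℂ) *
      Complex.exp (-π / ((z.im / t : ℝ) : ℂ) * (n + Complex.I * (-Complex.I * (m * z.re))) ^ 2) := by
    have : Complex.I * (-Complex.I * (m * z.re)) = m * z.re := by
      linear_combination (-(m : ℂ) * z.re) * Complex.I_mul_I
    rw [this]
    have h3 : -π / ((z.im / t : ℝ) : ℂ) * (n + m * z.re) ^ 2 = ((-π / (z.im / t) * (n + m * z.re) ^ 2 : ℝ) : ℂ) := by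
      push_cast; ring
    rw [h3, ← Complex.ofReal_exp, ← Complex.ofReal_mul, ← Real.exp_add]
    congr 2
    simp only [latticeForm, Matrix.cons_val_zero, Matrix.cons_val_one, Matrix.cons_val_fin_one]
    field_simp
    ring
  simp_rw [h1, h2, tsum_mul_left, h]
  field_simp

/-- Poisson summation in the second variable. -/
lemma one_add_latticeTheta_eq (z : ℍ) {t : ℝ} (ht : 0 < t) :
    ((1 + latticeTheta z t : ℝ) : ℂ) = √(z.im / t) * ∑' p, poissonTerm z t p := by
  have h := Complex.hasSum_ofReal.mpr (hasSum_exp_latticeForm z ht)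
  have h' := (finTwoArrowEquiv ℤ).symm.hasSum_iff.mpr h
  have h'' : Summable fun p : ℤ × ℤ ↦ ((Real.exp (-π * t * latticeForm z ![p.1, p.2]) : ℝ) : ℂ) := h'.summable
  have e : ((1 + latticeTheta z t : ℝ) : ℂ) = ∑' p : ℤ × ℤ, ((Real.exp (-π * t * latticeForm z ![p.1, p.2]) : ℝ) : ℂ) :=
    h'.tsum_eq.symm
  rw [e, h''.tsum_prod, (summable_poissonTerm z ht).tsum_prod, ← tsum_mul_left]
  exact tsum_congr fun m ↦ tsum_exp_latticeForm_row z ht m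

lemma latticeTheta_inv (z : ℍ) {t : ℝ} (ht : 0 < t) :
    1 + latticeTheta z t⁻¹ = t * (1 + latticeTheta z t) := by
  have h1 := one_add_latticeTheta_eq z (inv_pos.mpr ht)
  have h2 := one_add_latticeTheta_eq z ht
  simp_rw [poissonTerm_inv] at h1
  have h3 : ∑' p : ℤ × ℤ, poissonTerm z t p.swap = ∑' p, poissonTerm z t p :=
    (Equiv.prodComm ℤ ℤ).tsum_eq (poissonTerm z t)
  have h4 : √(z.im / t⁻¹) = t * √(z.im / t) := by
    rw [Real.sqrt_div' _ (inv_pos.mpr ht).le, Real.sqrt_div' _ ht.le, Real.sqrt_inv]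
    have := Real.sqrt_pos.mpr ht
    field_simp
    rw [Real.sq_sqrt ht.le]
  rw [h3, h4, Complex.ofReal_mul, mul_assoc, ← h2] at h1
  exact_mod_cast h1

/-- The part of `latticeTheta` whose Fourier expansion in `Re z` has no constant term. -/
noncomputable def nonconstTheta (z : ℍ) (t : ℝ) : ℝ :=
  latticeTheta z t - 2 * thetaTail (t / z.im) - √(z.im / t) * (2 * thetaTail (t * z.im))

/-- Jacobi's equation at y/t rewrites 1 + 2θ(t/y), so that the subtracted part is √(y/t) times an
expression invariant under t → 1/t. -/
lemma nonconstTheta_eq (z : ℍ) {t : ℝ} (ht : 0 < t) :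
    nonconstTheta z t = (1 + latticeTheta z t) -
      √(z.im / t) * (1 + 2 * thetaTail (z.im / t) + 2 * thetaTail (t * z.im)) := by
  have := thetaTail_inv (div_pos z.im_pos ht)
  rw [inv_div] at this
  rw [nonconstTheta]
  linarith

lemma nonconstTheta_inv (z : ℍ) {t : ℝ} (ht : 0 < t) :
    nonconstTheta z t⁻¹ = t * nonconstTheta z t := by
  rw [nonconstTheta_eq z ht, nonconstTheta_eq z (inv_pos.mpr ht), latticeTheta_inv z ht]
  have h4 : √(z.im / t⁻¹) = t * √(z.im / t) := by
    rw [Real.sqrt_div' _ (inv_pos.mpr ht).le, Real.sqrt_div' _ ht.le, Real.sqrt_inv]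
    have := Real.sqrt_pos.mpr ht
    field_simp
    rw [Real.sq_sqrt ht.le]
  rw [h4, div_inv_eq_mul, mul_comm t⁻¹, ← div_eq_mul_inv, mul_comm z.im t]
  ring

/-- Inclusion-exclusion deletes the Poisson terms with mk = 0. In the others the phase has modulus
1, leaving a product of two Gaussian sums over nonzero integers. -/
lemma abs_nonconstTheta_le (z : ℍ) {t : ℝ} (ht : 0 < t) :
    |nonconstTheta z t| ≤ √(z.im / t) * ((2 * thetaTail (t * z.im)) * (2 * thetaTail (z.im / t))) := by
  have hA := hasSum_int_exp_neg_sq (mul_pos ht z.im_pos)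
  have hB := hasSum_int_exp_neg_sq (div_pos z.im_pos ht)
  set a : ℤ → ℝ := fun n ↦ Real.exp (-π * (t * z.im) * (n : ℝ) ^ 2) with ha
  set b : ℤ → ℝ := fun n ↦ Real.exp (-π * (z.im / t) * (n : ℝ) ^ 2) with hb
  set e : ℤ → ℝ := fun n ↦ if n = 0 then 1 else 0 with he
  have a0 : a 0 = 1 := by simp [ha]
  have b0 : b 0 = 1 := by simp [hb]
  have hE : HasSum e 1 := hasSum_ite_eq 0 1
  have prodSum {f g : ℤ → ℝ} {A B : ℝ} (hf : HasSum f A) (hg : HasSum g B) :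
      HasSum (fun p : ℤ × ℤ ↦ f p.1 * g p.2) (A * B) :=
    hf.mul hg (summable_mul_of_summable_norm hf.summable.norm hg.summable.norm)
  have hmaj := prodSum (hA.sub hE) (hB.sub hE)
  have hT := (summable_poissonTerm z ht).hasSum
  have h1 := Complex.hasSum_ofReal.mpr (prodSum hE hB)
  have h2 := Complex.hasSum_ofReal.mpr (prodSum hA hE)
  have h3 := Complex.hasSum_ofReal.mpr (prodSum hE hE)
  have hD := ((hT.sub h1).sub h2).add h3
  have hle : ∀ p : ℤ × ℤ, ‖poissonTerm z t p - ((e p.1 * b p.2 : ℝ) : ℂ) - ((a p.1 * e p.2 : ℝ) : ℂ)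
      + ((e p.1 * e p.2 : ℝ) : ℂ)‖ ≤ (a p.1 - e p.1) * (b p.2 - e p.2) := by
    rintro ⟨m, k⟩
    by_cases hm : m = 0
    · subst hm
      have : poissonTerm z t (0, k) = (b k : ℂ) := by simp [poissonTerm, hb]
      simp [this, he, a0]
    · by_cases hk : k = 0
      · subst hk
        have : poissonTerm z t (m, 0) = (a m : ℂ) := by simp [poissonTerm, ha]
        simp [this, he, b0]
      · simp [he, hm, hk, norm_poissonTerm, ha, hb]
  have hfin := hD.norm_le_of_bounded hmaj hle
  have hid : (nonconstTheta z t : ℂ) = √(z.im / t) * (∑' p, poissonTerm z t p - ((1 * (1 + 2 * thetaTail (z.im / t)) : ℝ) : ℂ)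
      - (((1 + 2 * thetaTail (t * z.im)) * 1 : ℝ) : ℂ) + ((1 * 1 : ℝ) : ℂ)) := by
    rw [nonconstTheta_eq z ht, Complex.ofReal_sub, one_add_latticeTheta_eq z ht]
    push_cast
    ring
  rw [← Real.norm_eq_abs, ← Complex.norm_real, hid, norm_mul, Complex.norm_real,
    Real.norm_of_nonneg (Real.sqrt_nonneg _)]
  refine mul_le_mul_of_nonneg_left (hfin.trans (le_of_eq ?_)) (Real.sqrt_nonneg _)
  ring

lemma exists_abs_nonconstTheta_le {a b : ℝ} (ha : 1 / 2 < a) (hb : 1 / 2 < b) :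
    ∃ C, 0 < C ∧ ∀ (z : ℍ) (t : ℝ), 0 < t →
      |nonconstTheta z t| ≤ C * z.im ^ (1 / 2 - a - b) * t ^ (b - a - 1 / 2) := by
  obtain ⟨A, hA, hA'⟩ := exists_thetaTail_le ha
  obtain ⟨B, hB, hB'⟩ := exists_thetaTail_le hb
  refine ⟨4 * A * B, by positivity, fun z t ht ↦ (abs_nonconstTheta_le z ht).trans ?_⟩
  have hy := z.im_pos
  calc _ ≤ √(z.im / t) * ((2 * (A * (t * z.im) ^ (-a))) * (2 * (B * (z.im / t) ^ (-b)))) := by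
        have := thetaTail_nonneg (z.im / t)
        gcongr
        · exact hA' _ (by positivity)
        · exact hB' _ (by positivity)
    _ = _ := by
        rw [Real.sqrt_eq_rpow, Real.div_rpow hy.le ht.le, Real.div_rpow hy.le ht.le,
          Real.mul_rpow ht.le hy.le, show 1 / 2 - a - b = 1 / 2 + -a + -b by ring,
          show b - a - 1 / 2 = -(1 / 2) + -a + -(-b) by ring, Real.rpow_add hy, Real.rpow_add hy,
          Real.rpow_add ht, Real.rpow_add ht, Real.rpow_neg ht.le (1 / 2), Real.rpow_neg ht.le (-b)]
        ring

/-! ### Reduction to primitive vectors -/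

/-- Every nonzero integer vector is uniquely a positive multiple of a primitive one. -/
lemma bijective_smul_coprime : Function.Bijective
    (fun q : {p : Fin 2 → ℤ // IsCoprime (p 0) (p 1)} × ℕ ↦
      (⟨((q.2 : ℤ) + 1) • q.1.1, by
        intro h
        have h' := smul_eq_zero.mp h
        rcases h' with h' | h'
        · omega
        · have := q.1.2
          simp [h', isCoprime_zero_left] at this⟩ : {x : Fin 2 → ℤ // x ≠ 0})) := by
  have key (p : Fin 2 → ℤ) (hp : IsCoprime (p 0) (p 1)) (k : ℕ) :
      EisensteinSeries.finGcdMap (((k : ℤ) + 1) • p) = k + 1 := by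
    rw [EisensteinSeries.finGcdMap_smul _ (Int.isCoprime_iff_gcd_eq_one.mp hp)]
    omega
  constructor
  · rintro ⟨⟨p, hp⟩, k⟩ ⟨⟨p', hp'⟩, k'⟩ h
    have h : ((k : ℤ) + 1) • p = ((k' : ℤ) + 1) • p' := congrArg Subtype.val h
    have hk : k = k' := by
      have := congrArg EisensteinSeries.finGcdMap h
      rw [key p hp, key p' hp'] at this
      omega
    subst hk
    have : p = p' := smul_right_injective _ (show (k : ℤ) + 1 ≠ 0 by omega) h
    subst this
    rfl
  · rintro ⟨x, hx⟩
    have hg : EisensteinSeries.finGcdMap x ≠ 0 := by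
      intro h
      rw [EisensteinSeries.finGcdMap, Int.gcd_eq_zero_iff] at h
      exact hx (by ext i; fin_cases i <;> simp [h])
    obtain ⟨k, hk⟩ := Nat.exists_eq_succ_of_ne_zero hg
    refine ⟨⟨⟨fun i ↦ x i / (k + 1 : ℤ), ?_⟩, k⟩, ?_⟩
    · have := Int.gcd_ediv_gcd_ediv_gcd (i := x 0) (j := x 1) (Nat.pos_of_ne_zero hg)
      have e : (((x 0).gcd (x 1) : ℕ) : ℤ) = k + 1 := by rw [show (x 0).gcd (x 1) = k.succ from hk]; simp
      rwa [e, ← Int.isCoprime_iff_gcd_eq_one] at this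
    · refine Subtype.ext (funext fun i ↦ ?_)
      have e : (((x 0).gcd (x 1) : ℕ) : ℤ) = k + 1 := by rw [show (x 0).gcd (x 1) = k.succ from hk]; simp
      have hd : (k + 1 : ℤ) ∣ x i := by
        rw [← e]; fin_cases i
        · exact Int.gcd_dvd_left ..
        · exact Int.gcd_dvd_right ..
      exact Int.mul_ediv_cancel' hd

/-- Group the nonzero vectors by primitive direction and use Q((k + 1)p) = (k + 1)²Q(p). -/
lemma hasSum_thetaTail_coprime (z : ℍ) {t : ℝ} (ht : 0 < t) :
    HasSum (fun p : {p : Fin 2 → ℤ // IsCoprime (p 0) (p 1)} ↦ thetaTail (t * latticeForm z p))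
      (latticeTheta z t) := by
  have h : HasSum _ (latticeTheta z t) := ((summable_exp_latticeForm z ht).subtype {x | x ≠ 0}).hasSum
  have h' := (Equiv.ofBijective _ bijective_smul_coprime).hasSum_iff.mpr h
  refine h'.prod_fiberwise fun p ↦ ?_
  have hp : (p : Fin 2 → ℤ) ≠ 0 := by
    intro h0
    have := p.2
    simp [h0, isCoprime_zero_left] at this
  have h2 : HasSum _ (thetaTail (t * latticeForm z p)) :=
    (summable_thetaTail (mul_pos ht (latticeForm_pos z hp))).hasSum
  convert h2 using 2 with k
  simp only [Function.comp_apply, Equiv.ofBijective_apply]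
  congr 1
  simp only [latticeForm, Pi.smul_apply, smul_eq_mul]
  push_cast
  ring

/-! ### The fundamental domain and unfolding -/

instance : Countable SL(2, ℤ) :=
  haveI : Countable (Matrix (Fin 2) (Fin 2) ℤ) := inferInstanceAs (Countable (Fin 2 → Fin 2 → ℤ))
  inferInstanceAs (Countable {A : Matrix (Fin 2) (Fin 2) ℤ // A.det = 1})

lemma measurePreserving_smul_SL (γ : SL(2, ℤ)) :
    MeasurePreserving (fun z : ℍ ↦ γ • z) volume volume :=
  measurePreserving_smul (γ : GL (Fin 2) ℝ) (volume : Measure ℍ)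

lemma measurableEmbedding_smul_SL (γ : SL(2, ℤ)) : MeasurableEmbedding (fun z : ℍ ↦ γ • z) :=
  measurableEmbedding_const_smul (γ : GL (Fin 2) ℝ)

lemma volume_eq_zero_of_image {s : Set ℍ} (hs : volume (((↑) : ℍ → ℂ) '' s) = 0) : volume s = 0 := by
  rw [UpperHalfPlane.volume_eq_lintegral]
  exact setLIntegral_measure_zero _ _ hs

lemma volume_re_eq (c : ℝ) : volume {z : ℂ | z.re = c} = 0 := by
  have h := Complex.volume_preserving_equiv_real_prod.measure_preimage
    (s := {c} ×ˢ (univ : Set ℝ)) ((measurableSet_singleton c).prod MeasurableSet.univ).nullMeasurableSet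
  have e : Complex.measurableEquivRealProd ⁻¹' ({c} ×ˢ (univ : Set ℝ)) = {z : ℂ | z.re = c} := by
    ext z; simp [Complex.measurableEquivRealProd_apply]
  rw [e] at h
  rw [h, Measure.volume_eq_prod, Measure.prod_prod]
  simp

lemma volume_fd_diff_fdo : volume (𝒟 \ 𝒟ᵒ) = 0 := by
  refine volume_eq_zero_of_image (measure_mono_null (t := Metric.sphere (0 : ℂ) 1 ∪ ({z : ℂ | z.re = 1 / 2} ∪ {z : ℂ | z.re = -(1 / 2)})) ?_ ?_)
  · rintro _ ⟨z, ⟨⟨h1, h2⟩, h3⟩, rfl⟩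
    rcases h1.lt_or_eq with h1 | h1
    · right
      have h2' : |z.re| = 1 / 2 := by
        by_contra h
        exact h3 ⟨h1, lt_of_le_of_ne h2 h⟩
      rcases abs_eq (by norm_num : (0 : ℝ) ≤ 1 / 2) |>.mp h2' with h | h
      · exact Or.inl h
      · exact Or.inr h
    · left
      rw [mem_sphere_zero_iff_norm]
      rw [Complex.normSq_eq_norm_sq] at h1
      exact (sq_eq_sq₀ (norm_nonneg _) zero_le_one).mp (by rw [one_pow]; exact h1.symm)
  · rw [measure_union_null_iff, measure_union_null_iff]
    exact ⟨Measure.addHaar_sphere _ _ _, volume_re_eq _, volume_re_eq _⟩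

lemma ae_forall_smul_mem_fdo :
    ∀ᵐ z : ℍ, ∀ γ : SL(2, ℤ), γ • z ∈ 𝒟 → γ • z ∈ 𝒟ᵒ := by
  rw [ae_all_iff]
  intro γ
  have h := (measurePreserving_smul_SL γ).quasiMeasurePreserving.ae
    (p := fun z ↦ z ∈ 𝒟 → z ∈ 𝒟ᵒ) ?_
  · exact h
  · rw [ae_iff]
    convert volume_fd_diff_fdo using 2
    ext z
    simp

/-- Two elements moving such a z into 𝒟 differ by a sign, because its images in 𝒟 are interior. This
pair is the factor 2 in the unfolding identities. -/
lemma setOf_smul_mem_fd {z : ℍ} (hz : ∀ γ : SL(2, ℤ), γ • z ∈ 𝒟 → γ • z ∈ 𝒟ᵒ) :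
    ∃ γ₀ : SL(2, ℤ), {γ : SL(2, ℤ) | γ • z ∈ 𝒟} = {γ₀, -γ₀} := by
  obtain ⟨γ₀, h₀⟩ := ModularGroup.exists_smul_mem_fd z
  refine ⟨γ₀, Set.ext fun γ ↦ ⟨fun h ↦ ?_, ?_⟩⟩
  · have h' : (γ * γ₀⁻¹) • (γ₀ • z) ∈ 𝒟 := by rwa [mul_smul, inv_smul_smul]
    rcases ModularGroup.eq_one_or_neg_one_of_mem_fdo_mem_fd (hz γ₀ h₀) h' with h1 | h1
    · left; exact mul_inv_eq_one.mp h1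
    · right
      rw [mul_inv_eq_iff_eq_mul] at h1
      rw [mem_singleton_iff, h1, neg_one_mul]
  · rintro (rfl | rfl)
    · exact h₀
    · have : (-γ₀) • z = γ₀ • z := ModularGroup.SL_neg_smul γ₀ z
      rw [mem_ofPred_eq, this]; exact h₀

lemma neg_ne_self_SL (γ : SL(2, ℤ)) : γ ≠ -γ := by
  intro h
  have h0 : γ 1 0 = 0 := by
    have := congrArg (fun g : SL(2, ℤ) ↦ g 1 0) h
    simp at this; omega
  have h1 : γ 1 1 = 0 := by
    have := congrArg (fun g : SL(2, ℤ) ↦ g 1 1) h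
    simp at this; omega
  have := ModularGroup.bottom_row_coprime γ
  simp [h0, h1, isCoprime_zero_left] at this

/-- Summation over the translates that land in the fundamental domain. -/
lemma hasSum_indicator_fd {α : Type*} [AddCommMonoid α] [TopologicalSpace α]
    {z : ℍ} (hz : ∀ γ : SL(2, ℤ), γ • z ∈ 𝒟 → γ • z ∈ 𝒟ᵒ) (c : α) :
    HasSum (fun γ : SL(2, ℤ) ↦ (𝒟 : Set ℍ).indicator (fun _ ↦ c) (γ • z)) (2 • c) := by
  classical
  obtain ⟨γ₀, h₀⟩ := setOf_smul_mem_fd hz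
  have h : ∀ γ ∉ ({γ₀, -γ₀} : Finset SL(2, ℤ)), (𝒟 : Set ℍ).indicator (fun _ ↦ c) (γ • z) = 0 := by
    intro γ hγ
    refine indicator_of_notMem (fun h ↦ hγ ?_) _
    have : γ ∈ ({γ₀, -γ₀} : Set SL(2, ℤ)) := h₀ ▸ h
    simpa using this
  have h' : HasSum (fun γ : SL(2, ℤ) ↦ (𝒟 : Set ℍ).indicator (fun _ ↦ c) (γ • z)) _ :=
    hasSum_sum_of_ne_finset_zero h
  have m1 : γ₀ • z ∈ 𝒟 := by
    have : γ₀ ∈ {γ : SL(2, ℤ) | γ • z ∈ 𝒟} := by rw [h₀]; simp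
    exact this
  have m2 : (-γ₀) • z ∈ 𝒟 := by
    have : -γ₀ ∈ {γ : SL(2, ℤ) | γ • z ∈ 𝒟} := by rw [h₀]; simp
    exact this
  rw [Finset.sum_pair (neg_ne_self_SL γ₀), indicator_of_mem m1, indicator_of_mem m2, ← two_nsmul] at h'
  exact h'

lemma measurableSet_fd : MeasurableSet (𝒟 : Set ℍ) := ModularGroup.isClosed_fd.measurableSet

/-- The nonnegative version needs no integrability; applied to norms, it supplies the finiteness
that lets sum and integral be exchanged in the complex version. -/
lemma lintegral_fd_tsum_smul {g : ℍ → ℝ≥0∞} (hg : AEMeasurable g) :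
    ∑' γ : SL(2, ℤ), ∫⁻ z in 𝒟, g (γ • z) = 2 * ∫⁻ z, g z := by
  have h1 (γ : SL(2, ℤ)) : ∫⁻ z in 𝒟, g (γ • z) =
      ∫⁻ z, (𝒟 : Set ℍ).indicator (fun _ ↦ g z) (γ⁻¹ • z) := by
    rw [← lintegral_indicator measurableSet_fd]
    refine (lintegral_congr fun z ↦ ?_).trans
      ((measurePreserving_smul_SL γ).lintegral_comp_emb (measurableEmbedding_smul_SL γ) _)
    rw [inv_smul_smul]
    rfl
  simp_rw [h1]
  rw [← lintegral_tsum, ← lintegral_const_mul'' _ hg]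
  · refine lintegral_congr_ae ?_
    filter_upwards [ae_forall_smul_mem_fdo] with z hz
    rw [← (Equiv.inv SL(2, ℤ)).tsum_eq]
    simp_rw [Equiv.inv_apply, inv_inv]
    rw [(hasSum_indicator_fd hz (g z)).tsum_eq, two_nsmul, two_mul]
  · intro γ
    have : (fun z ↦ (𝒟 : Set ℍ).indicator (fun _ ↦ g z) (γ⁻¹ • z)) =
        ((fun z ↦ γ⁻¹ • z) ⁻¹' (𝒟 : Set ℍ)).indicator g := rfl
    rw [this]
    exact hg.indicator ((measurePreserving_smul_SL γ⁻¹).measurable measurableSet_fd)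

/-- The unfolding identity. -/
lemma integral_fd_tsum_smul {g : ℍ → ℂ} (hg : Integrable g) :
    ∫ z in 𝒟, ∑' γ : SL(2, ℤ), g (γ • z) = 2 * ∫ z, g z := by
  have hm (γ : SL(2, ℤ)) : AEStronglyMeasurable (fun z ↦ g (γ • z)) :=
    hg.1.comp_measurePreserving (measurePreserving_smul_SL γ)
  have h1 (γ : SL(2, ℤ)) : ∫ z in 𝒟, g (γ • z) =
      ∫ z, (𝒟 : Set ℍ).indicator (fun _ ↦ g z) (γ⁻¹ • z) := by
    rw [← integral_indicator measurableSet_fd]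
    refine (integral_congr_ae (Eventually.of_forall fun z ↦ ?_)).trans
      ((measurePreserving_smul_SL γ).integral_comp (measurableEmbedding_smul_SL γ) _)
    rw [inv_smul_smul]
    rfl
  have hm2 (γ : SL(2, ℤ)) : AEStronglyMeasurable (fun z ↦ (𝒟 : Set ℍ).indicator (fun _ ↦ g z) (γ⁻¹ • z)) :=
    hg.1.indicator (s := (fun z ↦ γ⁻¹ • z) ⁻¹' (𝒟 : Set ℍ))
      ((measurePreserving_smul_SL γ⁻¹).measurable measurableSet_fd)
  have hfin : ∑' γ : SL(2, ℤ), ∫⁻ z in 𝒟, ‖g (γ • z)‖ₑ ≠ ⊤ := by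
    rw [lintegral_fd_tsum_smul (g := fun z ↦ ‖g z‖ₑ) hg.1.enorm]
    exact ENNReal.mul_ne_top (by simp) hg.2.ne
  have hfin2 : ∑' γ : SL(2, ℤ), ∫⁻ z, ‖(𝒟 : Set ℍ).indicator (fun _ ↦ g z) (γ⁻¹ • z)‖ₑ ≠ ⊤ := by
    convert hfin using 2
    funext γ
    rw [← lintegral_indicator measurableSet_fd]
    refine ((lintegral_congr fun z ↦ ?_).trans
      ((measurePreserving_smul_SL γ).lintegral_comp_emb (measurableEmbedding_smul_SL γ) _)).symm
    rw [inv_smul_smul, enorm_indicator_eq_indicator_enorm]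
    rfl
  rw [integral_tsum (fun γ ↦ (hm γ).restrict) hfin]
  simp_rw [h1]
  rw [← integral_tsum hm2 hfin2, ← integral_const_mul]
  refine integral_congr_ae ?_
  filter_upwards [ae_forall_smul_mem_fdo] with z hz
  rw [← (Equiv.inv SL(2, ℤ)).tsum_eq]
  simp_rw [Equiv.inv_apply, inv_inv]
  rw [(hasSum_indicator_fd hz (g z)).tsum_eq, two_nsmul, two_mul]

/-! ### The strip and coprime bottom rows -/

/-- A fundamental domain for integral translations. -/
def strip : Set ℍ := {z | z.re ∈ Ioc 0 1}

lemma measurableSet_strip : MeasurableSet strip :=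
  (Complex.measurable_re.comp UpperHalfPlane.measurable_coe) measurableSet_Ioc

/-- Equal bottom rows make γ'γ⁻¹ an integral translation, and a half-open strip of width 1 only
allows translation by 0. -/
lemma eq_of_row_eq_of_mem_strip {z : ℍ} {γ γ' : SL(2, ℤ)} (hrow : γ 1 = γ' 1)
    (h : γ • z ∈ strip) (h' : γ' • z ∈ strip) : γ = γ' := by
  have hr0 : γ 1 0 = γ' 1 0 := congrFun hrow 0
  have hr1 : γ 1 1 = γ' 1 1 := congrFun hrow 1
  have hdet := Matrix.det_fin_two γ'.1
  rw [γ'.2] at hdet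
  set g := γ' * γ⁻¹ with hg
  have g10 : g 1 0 = 0 := by
    simp [hg, Matrix.SpecialLinearGroup.coe_inv, Matrix.adjugate_fin_two, Matrix.mul_apply, hr0, hr1]
    ring
  have g11 : g 1 1 = 1 := by
    have hdet := Matrix.det_fin_two γ.1
    rw [γ.2] at hdet
    simp [hg, Matrix.SpecialLinearGroup.coe_inv, Matrix.adjugate_fin_two, Matrix.mul_apply]
    rw [← hr0, ← hr1]
    linarith
  have g00 : g 0 0 = 1 := by
    have hdet := Matrix.det_fin_two g.1
    rw [g.2, g10, g11] at hdet
    linarith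
  have hgz : g • (γ • z) = γ' • z := by rw [hg, mul_smul, inv_smul_smul]
  have hre : (γ' • z).re = (γ • z).re + g 0 1 := by
    have h1 : ((g • (γ • z) : ℍ) : ℂ) = (γ • z : ℍ) + ((g 0 1 : ℤ) : ℂ) := by
      rw [UpperHalfPlane.specialLinearGroup_apply]
      simp [g10, g11, g00]
    rw [hgz] at h1
    have := congrArg Complex.re h1
    simpa using this
  have g01 : g 0 1 = 0 := by
    have h3 := h.1; have h4 := h.2; have h5 := h'.1; have h6 := h'.2
    rw [hre] at h5 h6
    have h7 : (g 0 1 : ℝ) < 1 := by linarith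
    have h8 : (-1 : ℝ) < g 0 1 := by linarith
    have h7' : g 0 1 < 1 := by exact_mod_cast h7
    have h8' : -1 < g 0 1 := by exact_mod_cast h8
    omega
  have : g = 1 := by
    ext i j
    fin_cases i <;> fin_cases j <;> simp [g00, g01, g10, g11]
  rw [hg, mul_inv_eq_one] at this
  exact this.symm

lemma exists_row_eq_and_mem_strip (z : ℍ) {p : Fin 2 → ℤ} (hp : IsCoprime (p 0) (p 1)) :
    ∃ γ : SL(2, ℤ), γ 1 = p ∧ γ • z ∈ strip := by
  obtain ⟨γ, -, hγ⟩ := ModularGroup.bottom_row_surj hp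
  obtain ⟨m, hm, -⟩ := existsUnique_add_zsmul_mem_Ioc (one_pos : (0 : ℝ) < 1) (γ • z).re 0
  refine ⟨ModularGroup.T ^ m * γ, ?_, ?_⟩
  · rw [← hγ]
    have := ModularGroup.T_pow_mul_apply_one m γ
    exact this
  · rw [mul_smul]
    rw [strip, mem_ofPred_eq, ModularGroup.re_T_zpow_smul]
    simpa using hm

/-- For each `z`, the elements of `SL(2, ℤ)` moving `z` into the strip correspond to the coprime
pairs of integers. -/
noncomputable def stripEquiv (z : ℍ) :
    {γ : SL(2, ℤ) // γ • z ∈ strip} ≃ {p : Fin 2 → ℤ // IsCoprime (p 0) (p 1)} :=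
  Equiv.ofBijective (fun γ ↦ ⟨γ.1 1, ModularGroup.bottom_row_coprime γ.1⟩) <| by
    constructor
    · rintro ⟨γ, h⟩ ⟨γ', h'⟩ e
      exact Subtype.ext (eq_of_row_eq_of_mem_strip (congrArg Subtype.val e) h h')
    · rintro ⟨p, hp⟩
      obtain ⟨γ, h1, h2⟩ := exists_row_eq_and_mem_strip z hp
      exact ⟨⟨γ, h2⟩, Subtype.ext h1⟩

/-- The strip selects one representative per coset of the translations, so the group sum becomes a
sum over bottom rows, both signs included. -/
lemma tsum_strip_indicator {α : Type*} [AddCommMonoid α] [TopologicalSpace α] [T2Space α]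
    (z : ℍ) (u : ℍ → α) (v : (Fin 2 → ℤ) → α)
    (h : ∀ γ : SL(2, ℤ), u (γ • z) = v (γ 1)) :
    ∑' γ : SL(2, ℤ), strip.indicator u (γ • z) =
      ∑' p : {p : Fin 2 → ℤ // IsCoprime (p 0) (p 1)}, v p := by
  have h1 : (fun γ : SL(2, ℤ) ↦ strip.indicator u (γ • z)) =
      ({γ : SL(2, ℤ) | γ • z ∈ strip}).indicator fun γ ↦ v (γ 1) := by
    funext γ
    by_cases hγ : γ • z ∈ strip
    · rw [indicator_of_mem hγ, indicator_of_mem (show γ ∈ {γ : SL(2, ℤ) | γ • z ∈ strip} from hγ), h]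
    · rw [indicator_of_notMem hγ, indicator_of_notMem (show γ ∉ {γ : SL(2, ℤ) | γ • z ∈ strip} from hγ)]
  rw [h1, ← tsum_subtype]
  exact (stripEquiv z).tsum_eq (fun p ↦ v p.1)

lemma im_smul_eq_inv_latticeForm (γ : SL(2, ℤ)) (z : ℍ) : (γ • z).im = (latticeForm z (γ 1))⁻¹ := by
  rw [ModularGroup.im_smul_eq_div_normSq, ModularGroup.denom_apply, latticeForm_eq_norm_sq, inv_div,
    Complex.normSq_eq_norm_sq]

/-- Since Im(γz) = 1/Q, this says that translates of 𝒟 with nonzero lower left entry stay at height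
at most 1. For y ≥ 1 use Q ≥ m²y; for y ≤ 1 the quadratic bound gives Qy ≥ 1. -/
lemma one_le_latticeForm {z : ℍ} (hz : z ∈ 𝒟) {x : Fin 2 → ℤ} (hx : x 0 ≠ 0) :
    1 ≤ latticeForm z x := by
  have hy := z.im_pos
  have hm : (1 : ℝ) ≤ |(x 0 : ℝ)| := by exact_mod_cast Int.one_le_abs hx
  rcases le_total 1 z.im with h | h
  · rw [latticeForm, le_div_iff₀ hy]
    have : (x 0 * z.im) ^ 2 = |(x 0 : ℝ)| ^ 2 * z.im ^ 2 := by rw [sq_abs]; ring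
    rw [this]
    have h2 : 1 ≤ |(x 0 : ℝ)| ^ 2 := by nlinarith
    nlinarith [sq_nonneg (x 0 * z.re + x 1), sq_nonneg z.im]
  · have h4 := quadratic_le_latticeForm_mul_im hz x
    have h5 : 1 ≤ |(x 0 : ℝ)| ^ 2 - |(x 0 : ℝ)| * |(x 1 : ℝ)| + |(x 1 : ℝ)| ^ 2 := by
      by_cases h1 : x 1 = 0
      · rw [h1]; norm_num; nlinarith
      · have : (1 : ℝ) ≤ |(x 1 : ℝ)| := by exact_mod_cast Int.one_le_abs h1
        nlinarith [sq_nonneg (|(x 0 : ℝ)| - |(x 1 : ℝ)|)]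
    have h6 : 0 ≤ latticeForm z x := by unfold latticeForm; positivity
    nlinarith

lemma latticeForm_of_eq_zero (z : ℍ) {x : Fin 2 → ℤ} (hx : IsCoprime (x 0) (x 1)) (h0 : x 0 = 0) :
    latticeForm z x = z.im⁻¹ := by
  rw [h0, isCoprime_zero_left, Int.isUnit_iff] at hx
  rw [latticeForm, h0]
  rcases hx with h | h <;> simp [h]

/-! ### The invariant measure in coordinates -/

/-- The measure `dy / y²` on the positive reals. -/
noncomputable def imMeasure : Measure ℝ :=
  (volume.restrict (Ioi 0)).withDensity fun y ↦ ((1 / ‖y‖₊ ^ 2 : NNReal) : ℝ≥0∞)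

lemma measurable_imDensity : Measurable fun y : ℝ ↦ ((1 / ‖y‖₊ ^ 2 : NNReal) : ℝ≥0∞) := by fun_prop

instance : SigmaFinite imMeasure := by
  unfold imMeasure
  exact SigmaFinite.withDensity fun y : ℝ ↦ (1 / ‖y‖₊ ^ 2 : NNReal)

/-- The coordinates `(Im z, Re z)`. -/
noncomputable def imRe (z : ℍ) : ℝ × ℝ := (z.im, z.re)

lemma measurable_im : Measurable fun z : ℍ ↦ z.im :=
  Complex.measurable_im.comp UpperHalfPlane.measurable_coe

lemma measurableEmbedding_imRe : MeasurableEmbedding imRe := by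
  have h : MeasurableEmbedding (Prod.swap ∘ Complex.measurableEquivRealProd ∘ ((↑) : ℍ → ℂ)) :=
    (MeasurableEquiv.prodComm (α := ℝ) (β := ℝ)).measurableEmbedding.comp
      (Complex.measurableEquivRealProd.measurableEmbedding.comp UpperHalfPlane.measurableEmbedding_coe)
  exact h

/-- The height comes first so that Fubini leaves the x-integral, that is the constant term, inside.
-/
lemma measurePreserving_imRe :
    MeasurePreserving imRe (volume : Measure ℍ) (imMeasure.prod (volume : Measure ℝ)) := by
  refine ⟨measurableEmbedding_imRe.measurable, (Measure.prod_eq fun s t hs ht ↦ ?_).symm⟩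
  rw [Measure.map_apply measurableEmbedding_imRe.measurable (hs.prod ht),
    UpperHalfPlane.volume_eq_lintegral]
  have e : ((↑) : ℍ → ℂ) '' (imRe ⁻¹' s ×ˢ t) =
      Complex.measurableEquivRealProd ⁻¹' (t ×ˢ (s ∩ Ioi 0)) := by
    ext z
    constructor
    · rintro ⟨w, ⟨h1, h2⟩, rfl⟩
      exact ⟨h2, h1, w.im_pos⟩
    · rintro ⟨h2, h1, h0⟩
      exact ⟨⟨z, h0⟩, ⟨h1, h2⟩, rfl⟩
  rw [e]
  have h := Complex.volume_preserving_equiv_real_prod.setLIntegral_comp_preimage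
    (s := t ×ˢ (s ∩ Ioi 0)) (ht.prod (hs.inter measurableSet_Ioi))
    (f := fun p ↦ ((1 / ‖p.2‖₊ ^ 2 : NNReal) : ℝ≥0∞)) (measurable_imDensity.comp measurable_snd)
  have h' : ∫⁻ z in Complex.measurableEquivRealProd ⁻¹' (t ×ˢ (s ∩ Ioi 0)), (((1 / ‖z.im‖₊) ^ 2 : NNReal) : ℝ≥0∞)
      = ∫⁻ p in t ×ˢ (s ∩ Ioi 0), ((1 / ‖p.2‖₊ ^ 2 : NNReal) : ℝ≥0∞) := by
    rw [← h]
    refine lintegral_congr fun z ↦ ?_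
    rw [div_pow, one_pow]
    rfl
  rw [h', Measure.volume_eq_prod, ← Measure.prod_restrict]
  have h2 := lintegral_prod_mul (μ := (volume : Measure ℝ).restrict t) (ν := (volume : Measure ℝ).restrict (s ∩ Ioi 0))
    (f := fun _ ↦ 1) (g := fun y ↦ ((1 / ‖y‖₊ ^ 2 : NNReal) : ℝ≥0∞)) aemeasurable_const measurable_imDensity.aemeasurable
  simp only [one_mul] at h2
  rw [h2, lintegral_const, one_mul, Measure.restrict_apply_univ, imMeasure,
    withDensity_apply _ hs, Measure.restrict_restrict hs, mul_comm]

lemma volume_fd_lt_top : volume (𝒟 : Set ℍ) < ∞ := by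
  have hsub : (𝒟 : Set ℍ) ⊆ imRe ⁻¹' (Ioi (1 / 2) ×ˢ Icc (-1 / 2) (1 / 2)) := by
    intro z hz
    have h1 := ModularGroup.three_le_four_mul_im_sq_of_mem_fd hz
    have h2 := abs_le.mp hz.2
    refine ⟨?_, ?_, ?_⟩
    · change 1 / 2 < z.im
      nlinarith [z.im_pos]
    · change -1 / 2 ≤ z.re
      linarith
    · exact h2.2
  refine (measure_mono hsub).trans_lt ?_
  rw [measurePreserving_imRe.measure_preimage (measurableSet_Ioi.prod measurableSet_Icc).nullMeasurableSet,
    Measure.prod_prod]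
  refine ENNReal.mul_lt_top ?_ (by simp)
  rw [imMeasure, withDensity_apply _ measurableSet_Ioi, Measure.restrict_restrict measurableSet_Ioi]
  have hs : Ioi (1 / 2 : ℝ) ∩ Ioi 0 = Ioi (1 / 2) := by
    rw [Ioi_inter_Ioi]; norm_num
  rw [hs]
  have hint := integrableOn_Ioi_rpow_of_lt (a := -2) (by norm_num) (show (0 : ℝ) < 1 / 2 by norm_num)
  have := hint.2
  rw [hasFiniteIntegral_iff_enorm] at this
  refine lt_of_eq_of_lt (setLIntegral_congr_fun measurableSet_Ioi fun y hy ↦ ?_) this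
  have hy : 0 < y := lt_trans (by norm_num) hy
  rw [enorm_eq_nnnorm]
  congr 1
  ext
  rw [coe_nnnorm, Real.norm_of_nonneg (by positivity), Real.rpow_neg hy.le]
  simp

/-! ### Truncation and integrability -/

/-- The restriction of a function to `y > 1`. -/
noncomputable def cutoff (φ : ℝ → ℂ) (y : ℝ) : ℂ := if 1 < y then φ y else 0

/-- The function `f` with its growing part removed in the cuspidal region `y > 1`. -/
noncomputable def truncation (f : ℍ → ℂ) (φ : ℝ → ℂ) (z : ℍ) : ℂ := f z - cutoff φ z.im

lemma im_smul_of_zero (γ : SL(2, ℤ)) (z : ℍ) (h : γ 1 0 = 0) : (γ • z).im = z.im := by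
  rw [im_smul_eq_inv_latticeForm, latticeForm_of_eq_zero z (ModularGroup.bottom_row_coprime γ) h, inv_inv]

/-- Cutting at y = 1 is what makes this work: a translate with nonzero lower left entry has height
at most 1, where the cutoff vanishes. -/
lemma truncation_smul {f : ℍ → ℂ} (hf : ∀ (γ : SL(2, ℤ)) (z : ℍ), f (γ • z) = f z) (φ : ℝ → ℂ)
    {z : ℍ} (hz : z ∈ 𝒟) (γ : SL(2, ℤ)) :
    truncation f φ (γ • z) = f z - if γ 1 0 = 0 then cutoff φ z.im else 0 := by
  rw [truncation, hf]
  congr 1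
  split_ifs with h
  · rw [im_smul_of_zero γ z h]
  · rw [cutoff, if_neg]
    rw [im_smul_eq_inv_latticeForm, not_lt]
    exact inv_le_one_of_one_le₀ (one_le_latticeForm hz h)

section integrability

variable {f : ℍ → ℂ} {φ : ℝ → ℂ}

lemma continuous_comp_im (hφ : ContinuousOn φ (Ioi 0)) : Continuous fun z : ℍ ↦ φ z.im :=
  hφ.comp_continuous UpperHalfPlane.continuous_im fun z ↦ z.im_pos

lemma measurable_cutoff_im (hφ : ContinuousOn φ (Ioi 0)) : Measurable fun z : ℍ ↦ cutoff φ z.im :=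
  Measurable.ite (measurableSet_lt measurable_const measurable_im) (continuous_comp_im hφ).measurable
    measurable_const

lemma continuous_im_rpow (a : ℝ) : Continuous fun z : ℍ ↦ ((z.im ^ a : ℝ) : ℂ) :=
  Complex.continuous_ofReal.comp
    (UpperHalfPlane.continuous_im.rpow_const fun z ↦ Or.inl z.im_pos.ne')

lemma aestronglyMeasurable_truncation (hf : LocallyIntegrable f) (hφ : ContinuousOn φ (Ioi 0)) :
    AEStronglyMeasurable (truncation f φ) :=
  hf.aestronglyMeasurable.sub (measurable_cutoff_im hφ).aestronglyMeasurable

/-- After removing its growing part, `f` is integrable against every power of `y` on the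
fundamental domain. -/
lemma integrableOn_truncation_mul_rpow (hf : LocallyIntegrable f) (hφ : ContinuousOn φ (Ioi 0))
    (hg : ∀ N : ℕ, (fun z : ℍ ↦ f z - φ z.im) =o[UpperHalfPlane.atImInfty]
      fun z : ℍ ↦ z.im ^ (-(N : ℝ))) (a : ℝ) :
    IntegrableOn (fun z ↦ truncation f φ z * ((z.im ^ a : ℝ) : ℂ)) 𝒟 := by
  obtain ⟨N, hN⟩ := exists_nat_ge a
  have h1 := (hg N).bound one_pos
  rw [Filter.Eventually, UpperHalfPlane.atImInfty_mem] at h1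
  obtain ⟨Y, hY⟩ := h1
  have hsplit : (𝒟 : Set ℍ) ⊆ ModularGroup.truncatedFundamentalDomain (max Y 1) ∪
      (𝒟 ∩ {z | max Y 1 < z.im}) := by
    intro z hz
    rcases le_or_gt z.im (max Y 1) with h | h
    · exact Or.inl ⟨hz, h⟩
    · exact Or.inr ⟨hz, h⟩
  -- The truncated domain is compact, so local integrability suffices there; on the cuspidal rest
  -- the integrand is bounded by 1 on a set of finite area.
  refine IntegrableOn.mono_set (IntegrableOn.union ?_ ?_) hsplit
  · have hK := ModularGroup.isCompact_truncatedFundamentalDomain (max Y 1)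
    refine IntegrableOn.mul_continuousOn ?_ (continuous_im_rpow a).continuousOn hK
    refine (hf.integrableOn_isCompact hK).sub ?_
    have : (fun z : ℍ ↦ cutoff φ z.im) = {z : ℍ | 1 < z.im}.indicator fun z ↦ φ z.im := by
      funext z; simp [cutoff, indicator]
    rw [this]
    exact ((continuous_comp_im hφ).continuousOn.integrableOn_compact hK).indicator
      (measurableSet_lt measurable_const measurable_im)
  · have hfin : volume (𝒟 ∩ {z : ℍ | max Y 1 < z.im}) < ∞ :=
      (measure_mono inter_subset_left).trans_lt volume_fd_lt_top
    refine Measure.integrableOn_of_bounded (M := 1) hfin.ne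
      ((aestronglyMeasurable_truncation hf hφ).mul (continuous_im_rpow a).aestronglyMeasurable) ?_
    refine (ae_restrict_iff' (measurableSet_fd.inter (measurableSet_lt measurable_const measurable_im))).mpr
      (Eventually.of_forall fun z hz ↦ ?_)
    have hz2 : max Y 1 < z.im := hz.2
    have hz1 : 1 < z.im := (le_max_right _ _).trans_lt hz2
    have hb : ‖f z - φ z.im‖ ≤ 1 * ‖z.im ^ (-(N : ℝ))‖ := hY z ((le_max_left _ _).trans hz2.le)
    have hpos := z.im_pos
    rw [one_mul, Real.norm_of_nonneg (by positivity)] at hb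
    rw [truncation, cutoff, if_pos hz1, norm_mul, Complex.norm_real, Real.norm_of_nonneg (by positivity)]
    calc _ ≤ z.im ^ (-(N : ℝ)) * z.im ^ a := by gcongr
      _ = z.im ^ (-(N : ℝ) + a) := (Real.rpow_add hpos _ _).symm
      _ ≤ 1 := Real.rpow_le_one_of_one_le_of_nonpos hz1.le (by linarith)

lemma integrableOn_cutoff_mul_rpow (hφ : ContinuousOn φ (Ioi 0)) {C A : ℝ}
    (hb : ∀ y, 1 < y → ‖φ y‖ ≤ C * y ^ A) {a : ℝ} (ha : a ≤ -A) :
    IntegrableOn (fun z : ℍ ↦ cutoff φ z.im * ((z.im ^ a : ℝ) : ℂ)) 𝒟 := by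
  refine Measure.integrableOn_of_bounded (M := C) volume_fd_lt_top.ne
    ((measurable_cutoff_im hφ).aestronglyMeasurable.mul (continuous_im_rpow a).aestronglyMeasurable)
    (Eventually.of_forall fun z ↦ ?_)
  have hC : 0 ≤ C := by
    have := (norm_nonneg _).trans (hb 2 (by norm_num))
    exact nonneg_of_mul_nonneg_left this (by positivity)
  have hpos := z.im_pos
  rw [cutoff, norm_mul, Complex.norm_real, Real.norm_of_nonneg (by positivity)]
  split_ifs with h
  · calc _ ≤ C * z.im ^ A * z.im ^ a := by gcongr; exact hb _ h
      _ = C * z.im ^ (A + a) := by rw [Real.rpow_add hpos]; ring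
      _ ≤ C * 1 := by gcongr; exact Real.rpow_le_one_of_one_le_of_nonpos h.le (by linarith)
      _ = C := mul_one C
  · simpa using hC

lemma integrableOn_mul_rpow (hf : LocallyIntegrable f) (hφ : ContinuousOn φ (Ioi 0))
    (hg : ∀ N : ℕ, (fun z : ℍ ↦ f z - φ z.im) =o[UpperHalfPlane.atImInfty]
      fun z : ℍ ↦ z.im ^ (-(N : ℝ))) {C A : ℝ}
    (hb : ∀ y, 1 < y → ‖φ y‖ ≤ C * y ^ A) {a : ℝ} (ha : a ≤ -A) :
    IntegrableOn (fun z ↦ f z * ((z.im ^ a : ℝ) : ℂ)) 𝒟 := by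
  refine ((integrableOn_truncation_mul_rpow hf hφ hg a).add
    (integrableOn_cutoff_mul_rpow hφ hb ha)).congr (Eventually.of_forall fun z ↦ ?_)
  simp only [Pi.add_apply, truncation]
  ring

/-- Of the σ factors 1/Q, two are bounded through Q ≥ 3‖x‖²/(4y), which makes the lattice sum
converge, and the other σ - 2 through Q ≥ y. -/
lemma inv_latticeForm_rpow_le {σ : ℝ} (hσ : 2 ≤ σ) {z : ℍ} (hz : z ∈ 𝒟) {x : Fin 2 → ℤ} (hx : x 0 ≠ 0) :
    ((latticeForm z x)⁻¹) ^ σ ≤ 2 * z.im ^ (4 - σ) * ‖x‖ ^ (-4 : ℝ) := by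
  have hy := z.im_pos
  have hx' : x ≠ 0 := fun h ↦ hx (by simp [h])
  have hn := norm_pos_iff.mpr hx'
  have h0 := latticeForm_pos z hx'
  have h1 : z.im ≤ latticeForm z x := by
    rw [latticeForm, le_div_iff₀ hy]
    have hm : (1 : ℝ) ≤ |(x 0 : ℝ)| := by exact_mod_cast Int.one_le_abs hx
    have : (x 0 * z.im) ^ 2 = |(x 0 : ℝ)| ^ 2 * z.im ^ 2 := by rw [sq_abs]; ring
    rw [this]
    have h2 : 1 ≤ |(x 0 : ℝ)| ^ 2 := by nlinarith
    nlinarith [sq_nonneg (x 0 * z.re + x 1), sq_nonneg z.im]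
  have h2 : 3 / 4 * ‖x‖ ^ 2 / z.im ≤ latticeForm z x := by
    rw [div_le_iff₀ hy]; exact norm_sq_le_latticeForm_mul_im hz x
  have h3 : (latticeForm z x)⁻¹ ^ (σ - 2) ≤ (z.im)⁻¹ ^ (σ - 2) := by
    refine Real.rpow_le_rpow (by positivity) ?_ (by linarith)
    gcongr
  have h4 : (latticeForm z x)⁻¹ ^ (2 : ℝ) ≤ (3 / 4 * ‖x‖ ^ 2 / z.im)⁻¹ ^ (2 : ℝ) := by
    refine Real.rpow_le_rpow (by positivity) ?_ (by norm_num)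
    gcongr
  calc _ = (latticeForm z x)⁻¹ ^ (σ - 2) * (latticeForm z x)⁻¹ ^ (2 : ℝ) := by
        rw [← Real.rpow_add (by positivity)]; congr 1; ring
    _ ≤ (z.im)⁻¹ ^ (σ - 2) * (3 / 4 * ‖x‖ ^ 2 / z.im)⁻¹ ^ (2 : ℝ) := by gcongr
    _ = 16 / 9 * z.im ^ (4 - σ) * ‖x‖ ^ (-4 : ℝ) := by
        rw [Real.inv_rpow hy.le, ← Real.rpow_neg hy.le, show 4 - σ = -(σ - 2) + 2 by ring,
          Real.rpow_add hy, Real.rpow_neg hn.le]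
        norm_cast
        field_simp
        norm_num
    _ ≤ _ := by gcongr; norm_num

lemma norm_eq_one_of_coprime {x : Fin 2 → ℤ} (hx : IsCoprime (x 0) (x 1)) (h0 : x 0 = 0) : ‖x‖ = 1 := by
  rw [h0, isCoprime_zero_left, Int.isUnit_iff] at hx
  rw [norm_eq_max_abs, h0]
  rcases hx with h | h <;> simp [h]

/-- After removing its growing part, `f` is integrable against sufficiently high powers of `y`
on the strip. -/
lemma integrableOn_strip (hf : LocallyIntegrable f)
    (hmod : ∀ (γ : SL(2, ℤ)) (z : ℍ), f (γ • z) = f z) (hφ : ContinuousOn φ (Ioi 0))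
    (hg : ∀ N : ℕ, (fun z : ℍ ↦ f z - φ z.im) =o[UpperHalfPlane.atImInfty]
      fun z : ℍ ↦ z.im ^ (-(N : ℝ))) {C A : ℝ}
    (hb : ∀ y, 1 < y → ‖φ y‖ ≤ C * y ^ A) {σ : ℝ} (hσ : 2 ≤ σ) (hσA : A + 4 ≤ σ) :
    IntegrableOn (fun z ↦ truncation f φ z * ((z.im ^ σ : ℝ) : ℂ)) strip := by
  have hm : AEStronglyMeasurable (fun z ↦ truncation f φ z * ((z.im ^ σ : ℝ) : ℂ)) :=
    (aestronglyMeasurable_truncation hf hφ).mul (continuous_im_rpow σ).aestronglyMeasurable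
  refine ⟨hm.restrict, ?_⟩
  rw [hasFiniteIntegral_iff_enorm, ← lintegral_indicator measurableSet_strip]
  set u : ℍ → ℝ≥0∞ := fun z ↦ ‖truncation f φ z * ((z.im ^ σ : ℝ) : ℂ)‖ₑ with hu
  have hum : AEMeasurable (strip.indicator u) := hm.enorm.indicator measurableSet_strip
  -- Unfolding is read backwards: twice the strip integral is an integral over 𝒟 of a sum over
  -- coprime pairs.
  have hunf := lintegral_fd_tsum_smul hum
  have hum2 (γ : SL(2, ℤ)) : AEMeasurable (fun z ↦ strip.indicator u (γ • z)) (volume.restrict 𝒟) :=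
    (hum.comp_quasiMeasurePreserving (measurePreserving_smul_SL γ).quasiMeasurePreserving).restrict
  rw [← lintegral_tsum hum2] at hunf
  set K : ℝ≥0∞ := ∑' p : {p : Fin 2 → ℤ // IsCoprime (p 0) (p 1)}, ENNReal.ofReal (‖p.1‖ ^ (-4 : ℝ)) with hK
  have hKtop : K ≠ ∞ := by
    have hs : Summable fun p : {p : Fin 2 → ℤ // IsCoprime (p 0) (p 1)} ↦ ‖p.1‖ ^ (-4 : ℝ) :=
      (EisensteinSeries.summable_one_div_norm_rpow (k := 4) (by norm_num)).subtype {p | IsCoprime (p 0) (p 1)}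
    rw [hK, ← ENNReal.ofReal_tsum_of_nonneg (fun _ ↦ by positivity) hs]
    exact ENNReal.ofReal_ne_top
  -- The first summand dominates the pairs (0, ±1), the second all others. Integrability of
  -- f·y^(4-σ) is where A + 4 ≤ σ enters.
  set w : ℍ → ℝ≥0∞ := fun z ↦ ‖truncation f φ z * ((z.im ^ σ : ℝ) : ℂ)‖ₑ +
    2 * ‖f z * ((z.im ^ (4 - σ) : ℝ) : ℂ)‖ₑ with hw
  have hwfin : ∫⁻ z in 𝒟, w z < ∞ := by
    have i1 := (integrableOn_truncation_mul_rpow hf hφ hg σ).2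
    have i2 := (integrableOn_mul_rpow hf hφ hg hb (a := 4 - σ) (by linarith)).2
    rw [hasFiniteIntegral_iff_enorm] at i1 i2
    rw [hw, lintegral_add_left' hm.enorm.restrict, lintegral_const_mul' _ _ (by simp)]
    exact ENNReal.add_lt_top.mpr ⟨i1, ENNReal.mul_lt_top (by simp) i2⟩
  have hle : ∀ z ∈ (𝒟 : Set ℍ), ∑' γ : SL(2, ℤ), strip.indicator u (γ • z) ≤ w z * K := by
    intro z hz
    rw [tsum_strip_indicator z u (fun p ↦ ‖(f z - if p 0 = 0 then cutoff φ z.im else 0) *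
      ((((latticeForm z p)⁻¹) ^ σ : ℝ) : ℂ)‖ₑ), hK, ← ENNReal.tsum_mul_left]
    · refine ENNReal.tsum_le_tsum fun p ↦ ?_
      obtain ⟨p, hp⟩ := p
      have hy := z.im_pos
      by_cases h0 : p 0 = 0
      · simp only [h0, if_true]
        rw [norm_eq_one_of_coprime hp h0, latticeForm_of_eq_zero z hp h0, inv_inv, Real.one_rpow,
          ENNReal.ofReal_one, mul_one]
        exact le_self_add
      · simp only [h0, if_false, sub_zero]
        have hpos : 0 < latticeForm z p := latticeForm_pos z (fun h ↦ h0 (by simp [h]))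
        rw [hw]
        refine le_trans ?_ (mul_le_mul_left (le_add_self) _)
        rw [← ofReal_norm, ← ofReal_norm, ← ENNReal.ofReal_ofNat 2, ← ENNReal.ofReal_mul (by norm_num),
          ← ENNReal.ofReal_mul (by positivity)]
        refine ENNReal.ofReal_le_ofReal ?_
        rw [norm_mul, norm_mul, Complex.norm_real, Complex.norm_real, Real.norm_of_nonneg (by positivity),
          Real.norm_of_nonneg (by positivity)]
        calc _ ≤ ‖f z‖ * (2 * z.im ^ (4 - σ) * ‖p‖ ^ (-4 : ℝ)) := by
              gcongr; exact inv_latticeForm_rpow_le hσ hz h0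
          _ = _ := by ring
    · intro γ
      simp only [hu]
      rw [truncation_smul hmod φ hz, im_smul_eq_inv_latticeForm]
  have hfin : ∫⁻ z in 𝒟, ∑' γ : SL(2, ℤ), strip.indicator u (γ • z) < ∞ := by
    refine (setLIntegral_mono' measurableSet_fd hle).trans_lt ?_
    rw [lintegral_mul_const' _ _ hKtop]
    exact ENNReal.mul_lt_top hwfin hKtop.lt_top
  rw [hunf] at hfin
  exact ENNReal.lt_top_of_mul_ne_top_right hfin.ne (by simp)

end integrability

/-! ### Mellin transforms of kernels and unfolding against theta -/

/-- The Mellin transform of a superposition of dilates of a kernel. -/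
lemma hasMellin_integral_comp_mul {X : Type*} [MeasurableSpace X] {μ : Measure X} [SFinite μ]
    {B : X → ℂ} {w : X → ℝ} {κ : ℝ → ℂ} {s k : ℂ} (hB : AEStronglyMeasurable B μ)
    (hw : Measurable w) (hw0 : ∀ x, 0 < w x) (hκm : Measurable κ) (hκ : HasMellin κ s k)
    (hint : Integrable (fun x ↦ B x * (w x : ℂ) ^ (-s)) μ) :
    HasMellin (fun t ↦ ∫ x, B x * κ (t * w x) ∂μ) s (k * ∫ x, B x * (w x : ℂ) ^ (-s) ∂μ) := by
  have hm : AEStronglyMeasurable (fun p : ℝ × X ↦ ((p.1 : ℂ) ^ (s - 1)) * (B p.2 * κ (p.1 * w p.2)))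
      ((volume.restrict (Ioi 0)).prod μ) := by
    refine AEStronglyMeasurable.mul ?_ (AEStronglyMeasurable.mul hB.comp_snd ?_)
    · exact Measurable.aestronglyMeasurable (by fun_prop)
    · exact (hκm.comp (measurable_fst.mul (hw.comp measurable_snd))).aestronglyMeasurable
  -- By scaling, the norm integral over each fibre is |B·w^(-s)| times a constant, so `hint` is
  -- exactly what Tonelli's criterion requires.
  have hnorm (x : X) : ∫ t in Ioi (0 : ℝ), ‖((t : ℂ) ^ (s - 1)) * (B x * κ (t * w x))‖ =
      ‖B x * (w x : ℂ) ^ (-s)‖ * ∫ t in Ioi (0 : ℝ), ‖((t : ℂ) ^ (s - 1)) * κ t‖ := by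
    have h := integral_comp_mul_right_Ioi (fun t : ℝ ↦ ‖((t : ℂ) ^ (s - 1)) * κ t‖) 0 (hw0 x)
    rw [zero_mul, smul_eq_mul, eq_inv_mul_iff_mul_eq₀ (hw0 x).ne'] at h
    rw [← h, ← integral_const_mul, ← integral_const_mul]
    refine setIntegral_congr_fun measurableSet_Ioi fun t ht ↦ ?_
    have ht : 0 < t := ht
    have h1 : ((t * w x : ℝ) : ℂ) ^ (s - 1) = (t : ℂ) ^ (s - 1) * (w x : ℂ) ^ (s - 1) := by
      rw [Complex.ofReal_mul, Complex.mul_cpow_ofReal_nonneg ht.le (hw0 x).le]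
    have h2 : ‖(w x : ℂ) ^ (-s)‖ * (w x * ‖(w x : ℂ) ^ (s - 1)‖) = 1 := by
      rw [Complex.norm_cpow_eq_rpow_re_of_pos (hw0 x), Complex.norm_cpow_eq_rpow_re_of_pos (hw0 x)]
      nth_rewrite 2 [← Real.rpow_one (w x)]
      rw [← Real.rpow_add (hw0 x), ← Real.rpow_add (hw0 x)]
      simp
    simp only [h1, norm_mul]
    linear_combination (-‖(t : ℂ) ^ (s - 1)‖ * ‖B x‖ * ‖κ (t * w x)‖) * h2
  have hprod : Integrable (fun p : ℝ × X ↦ ((p.1 : ℂ) ^ (s - 1)) * (B p.2 * κ (p.1 * w p.2)))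
      ((volume.restrict (Ioi 0)).prod μ) := by
    rw [integrable_prod_iff' hm]
    refine ⟨Eventually.of_forall fun x ↦ ?_, ?_⟩
    · have h : MellinConvergent (fun t ↦ κ (t * w x)) s := by
        simpa only [mul_comm] using (MellinConvergent.comp_mul_left (hw0 x)).mpr hκ.1
      have h' := h.const_mul (B x)
      refine h'.congr (Eventually.of_forall fun t ↦ ?_)
      simp only [smul_eq_mul]; ring
    · simp only [hnorm]
      exact hint.norm.mul_const _
  constructor
  · have h := hprod.integral_prod_left
    refine h.congr (Eventually.of_forall fun t ↦ ?_)
    simp only [smul_eq_mul, integral_const_mul]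
  · rw [mellin]
    simp_rw [smul_eq_mul, ← integral_const_mul]
    rw [integral_integral_swap hprod]
    refine integral_congr_ae (Eventually.of_forall fun x ↦ ?_)
    have h := mellin_comp_mul_right κ s (hw0 x)
    rw [hκ.2, mellin] at h
    simp only [smul_eq_mul] at h
    simp only []
    rw [show k * (B x * (w x : ℂ) ^ (-s)) = B x * ((w x : ℂ) ^ (-s) * k) by ring, ← h,
      ← integral_const_mul]
    refine integral_congr_ae (Eventually.of_forall fun t ↦ ?_)
    simp only []
    ring

lemma hasMellin_inv_sqrt_mul_thetaTail {s : ℂ} (hs : 1 < s.re) :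
    HasMellin (fun t ↦ (t : ℂ) ^ (-(1 / 2) : ℂ) * (thetaTail t : ℂ)) s
      (completedRiemannZeta (2 * s - 1)) := by
  have h := hasMellin_thetaTail (s := s + -(1 / 2)) (by
    rw [Complex.add_re, Complex.neg_re]; norm_num; linarith)
  refine ⟨?_, ?_⟩
  · exact MellinConvergent.cpow_smul.mpr h.1
  · have h2 := mellin_cpow_smul (fun t ↦ (thetaTail t : ℂ)) s (-(1 / 2))
    simp only [smul_eq_mul] at h2
    rw [h2, h.2]
    congr 1
    ring

section unfolding

variable {f : ℍ → ℂ} {φ : ℝ → ℂ}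

lemma hasSum_coprime_zero {M : Type*} [AddCommMonoid M] [TopologicalSpace M] (c : M) :
    HasSum (fun p : {p : Fin 2 → ℤ // IsCoprime (p 0) (p 1)} ↦ if p.1 0 = 0 then c else 0) (2 • c) := by
  classical
  set a : {p : Fin 2 → ℤ // IsCoprime (p 0) (p 1)} := ⟨![0, 1], by simp [isCoprime_zero_left]⟩ with ha
  set b : {p : Fin 2 → ℤ // IsCoprime (p 0) (p 1)} := ⟨![0, -1], by simp [isCoprime_zero_left]⟩ with hb
  have hab : a ≠ b := fun h ↦ by
    have := congrFun (congrArg Subtype.val h) 1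
    simp [ha, hb] at this
  have h : HasSum (fun p : {p : Fin 2 → ℤ // IsCoprime (p 0) (p 1)} ↦ if p.1 0 = 0 then c else 0) _ :=
    hasSum_sum_of_ne_finset_zero (s := {a, b}) (by
      rintro ⟨p, hp⟩ hmem
      refine if_neg fun h0 ↦ hmem ?_
      have h1 := hp
      simp only at h0
      rw [h0, isCoprime_zero_left, Int.isUnit_iff] at h1
      rw [Finset.mem_insert, Finset.mem_singleton]
      rcases h1 with h1 | h1
      · left; refine Subtype.ext (funext fun i ↦ ?_); fin_cases i <;> simp [ha, h0, h1]
      · right; refine Subtype.ext (funext fun i ↦ ?_); fin_cases i <;> simp [hb, h0, h1])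
  rw [Finset.sum_pair hab, if_pos (by simp [ha]), if_pos (by simp [hb]), ← two_nsmul] at h
  exact h

/-- The sum over all coprime rows rebuilds Θ, while φ is met only by the two rows (0, ±1), whence
the factor 2. -/
lemma tsum_truncation_mul_thetaTail (hmod : ∀ (γ : SL(2, ℤ)) (z : ℍ), f (γ • z) = f z) (φ : ℝ → ℂ)
    {z : ℍ} (hz : z ∈ 𝒟) {t : ℝ} (ht : 0 < t) :
    ∑' γ : SL(2, ℤ), strip.indicator (fun z ↦ truncation f φ z * thetaTail (t * z.im⁻¹)) (γ • z) =
      f z * latticeTheta z t - cutoff φ z.im * (2 * thetaTail (t * z.im⁻¹)) := by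
  rw [tsum_strip_indicator z _ (fun p ↦ (f z - if p 0 = 0 then cutoff φ z.im else 0) *
      (thetaTail (t * latticeForm z p) : ℂ))]
  · have h1 := (Complex.hasSum_ofReal.mpr (hasSum_thetaTail_coprime z ht)).mul_left (f z)
    have h2 := hasSum_coprime_zero (cutoff φ z.im * (thetaTail (t * z.im⁻¹) : ℂ))
    have h3 := (h1.sub h2).tsum_eq
    rw [two_nsmul] at h3
    rw [show f z * latticeTheta z t - cutoff φ z.im * (2 * thetaTail (t * z.im⁻¹)) =
      f z * latticeTheta z t - (cutoff φ z.im * thetaTail (t * z.im⁻¹) + cutoff φ z.im * thetaTail (t * z.im⁻¹)) by ring, ← h3]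
    refine tsum_congr fun p ↦ ?_
    split_ifs with h0
    · rw [latticeForm_of_eq_zero z p.2 h0]; ring
    · ring
  · intro γ
    rw [truncation_smul hmod φ hz, im_smul_eq_inv_latticeForm, inv_inv]

lemma measurable_thetaTail_comp {X : Type*} [MeasurableSpace X] {g : X → ℝ} (hg : Measurable g) :
    Measurable fun x ↦ (thetaTail (g x) : ℂ) :=
  Complex.measurable_ofReal.comp (measurable_thetaTail.comp hg)

lemma integrableOn_strip_mul_thetaTail {σ : ℝ} (hσ : 1 / 2 < σ)
    (hint : IntegrableOn (fun z ↦ truncation f φ z * ((z.im ^ σ : ℝ) : ℂ)) strip)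
    (hm : AEStronglyMeasurable (truncation f φ)) {t : ℝ} (ht : 0 < t) :
    IntegrableOn (fun z ↦ truncation f φ z * (thetaTail (t * z.im⁻¹) : ℂ)) strip := by
  obtain ⟨C, hC, h⟩ := exists_thetaTail_le hσ
  refine Integrable.mono' (hint.norm.const_mul (C * t ^ (-σ)))
    (hm.restrict.mul (measurable_thetaTail_comp (measurable_const.mul measurable_im.inv)).aestronglyMeasurable)
    (Eventually.of_forall fun z ↦ ?_)
  have hy := z.im_pos
  rw [norm_mul, norm_mul, Complex.norm_real, Complex.norm_real, Real.norm_of_nonneg (thetaTail_nonneg _),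
    Real.norm_of_nonneg (by positivity)]
  calc _ ≤ ‖truncation f φ z‖ * (C * (t * z.im⁻¹) ^ (-σ)) := by
        gcongr; exact h _ (by positivity)
    _ = _ := by
        rw [Real.mul_rpow ht.le (by positivity), Real.inv_rpow hy.le, ← Real.rpow_neg hy.le, neg_neg]
        ring

/-- Unfolding against the theta series. -/
lemma integral_fd_eq_integral_strip (hmod : ∀ (γ : SL(2, ℤ)) (z : ℍ), f (γ • z) = f z)
    {σ : ℝ} (hσ : 1 / 2 < σ)
    (hint : IntegrableOn (fun z ↦ truncation f φ z * ((z.im ^ σ : ℝ) : ℂ)) strip)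
    (hm : AEStronglyMeasurable (truncation f φ)) {t : ℝ} (ht : 0 < t) :
    ∫ z in 𝒟, (f z * latticeTheta z t - cutoff φ z.im * (2 * thetaTail (t * z.im⁻¹))) =
      2 * ∫ z in strip, truncation f φ z * thetaTail (t * z.im⁻¹) := by
  have hi := (integrableOn_strip_mul_thetaTail hσ hint hm ht).integrable_indicator measurableSet_strip
  rw [← integral_indicator measurableSet_strip, ← integral_fd_tsum_smul hi]
  exact setIntegral_congr_fun measurableSet_fd fun z hz ↦ (tsum_truncation_mul_thetaTail hmod φ hz ht).symm

end unfolding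

/-! ### The regularised theta integral and its functional equation -/

/-- Modular functions `f` which are asymptotic to `φ (Im z)`, where `φ` grows at most like `y ^ A`. -/
structure GrowsLike (f : ℍ → ℂ) (φ : ℝ → ℂ) (C A : ℝ) : Prop where
  locallyIntegrable : LocallyIntegrable f
  modular : ∀ (γ : SL(2, ℤ)) (z : ℍ), f (γ • z) = f z
  continuousOn : ContinuousOn φ (Ioi 0)
  isLittleO : ∀ N : ℕ, (fun z : ℍ ↦ f z - φ z.im) =o[UpperHalfPlane.atImInfty]
    fun z : ℍ ↦ z.im ^ (-(N : ℝ))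
  bound : ∀ y, 1 < y → ‖φ y‖ ≤ C * y ^ A

/-- The regularised integral of `f` against the theta series over the fundamental domain. -/
noncomputable def regularizedTheta (f : ℍ → ℂ) (φ : ℝ → ℂ) (t : ℝ) : ℂ :=
  ∫ z in 𝒟, (truncation f φ z * ((1 + latticeTheta z t : ℝ) : ℂ) +
    cutoff φ z.im * (nonconstTheta z t : ℂ))

/-- The limit of `regularizedTheta` at infinity. -/
noncomputable def regularizedMean (f : ℍ → ℂ) (φ : ℝ → ℂ) : ℂ := ∫ z in 𝒟, truncation f φ z

lemma measurable_latticeTheta_left (t : ℝ) : Measurable fun z ↦ latticeTheta z t :=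
  measurable_latticeTheta.comp (measurable_id.prodMk measurable_const)

lemma measurable_nonconstTheta : Measurable fun p : ℍ × ℝ ↦ nonconstTheta p.1 p.2 := by
  have h1 : Measurable fun p : ℍ × ℝ ↦ p.1.im := measurable_im.comp measurable_fst
  unfold nonconstTheta
  refine (measurable_latticeTheta.sub (measurable_const.mul (measurable_thetaTail.comp (measurable_snd.div h1)))).sub
    (((h1.div measurable_snd).sqrt).mul (measurable_const.mul (measurable_thetaTail.comp (measurable_snd.mul h1))))

lemma measurable_nonconstTheta_left (t : ℝ) : Measurable fun z ↦ nonconstTheta z t :=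
  measurable_nonconstTheta.comp (measurable_id.prodMk measurable_const)

/-- Both 1 + Θ and `nonconstTheta` satisfy this equation pointwise in z, so no convergence is
involved. -/
lemma regularizedTheta_inv (f : ℍ → ℂ) (φ : ℝ → ℂ) {t : ℝ} (ht : 0 < t) :
    regularizedTheta f φ t⁻¹ = t * regularizedTheta f φ t := by
  rw [regularizedTheta, regularizedTheta, ← integral_const_mul]
  refine integral_congr_ae (Eventually.of_forall fun z ↦ ?_)
  simp only []
  rw [latticeTheta_inv z ht, nonconstTheta_inv z ht]
  push_cast
  ring

namespace GrowsLike

variable {f : ℍ → ℂ} {φ : ℝ → ℂ} {C A : ℝ} (h : GrowsLike f φ C A)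
include h

lemma aestronglyMeasurable : AEStronglyMeasurable (truncation f φ) :=
  aestronglyMeasurable_truncation h.locallyIntegrable h.continuousOn

lemma integrableOn_truncation : IntegrableOn (truncation f φ) 𝒟 := by
  simpa using integrableOn_truncation_mul_rpow h.locallyIntegrable h.continuousOn h.isLittleO 0

/-- Uniform domination of the theta integrand. -/
lemma exists_bound {r : ℝ} (hr : 1 < r) (hrA : A - 1 ≤ r) :
    ∃ g : ℍ → ℝ, IntegrableOn g 𝒟 ∧ ∀ z ∈ (𝒟 : Set ℍ), ∀ t, 0 < t →
      ‖truncation f φ z * (latticeTheta z t : ℂ)‖ ≤ g z * t ^ (-r) ∧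
      ‖cutoff φ z.im * (nonconstTheta z t : ℂ)‖ ≤ g z * t ^ (-r) := by
  obtain ⟨C₁, hC₁, h₁⟩ := exists_latticeTheta_le hr
  -- These exponents give t^(-r) and y^(-r-1); integrability of φ(y)·y^(-r-1) is the condition A - 1
  -- ≤ r.
  obtain ⟨C₂, hC₂, h₂⟩ := exists_abs_nonconstTheta_le (a := r + 1 / 2) (b := 1) (by linarith) (by norm_num)
  have i₁ := (integrableOn_truncation_mul_rpow h.locallyIntegrable h.continuousOn h.isLittleO r).norm.const_mul C₁
  have i₂ := (integrableOn_cutoff_mul_rpow h.continuousOn h.bound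
    (a := 1 / 2 - (r + 1 / 2) - 1) (by linarith)).norm.const_mul C₂
  refine ⟨_, i₁.add i₂, fun z hz t ht ↦ ?_⟩
  have hy := z.im_pos
  simp only [Pi.add_apply, norm_mul, Complex.norm_real]
  rw [Real.norm_of_nonneg (latticeTheta_nonneg _ _), Real.norm_eq_abs (nonconstTheta z t),
    Real.norm_of_nonneg (by positivity), Real.norm_of_nonneg (by positivity)]
  have a₁ : 0 ≤ C₁ * (‖truncation f φ z‖ * z.im ^ r) := by positivity
  have a₂ : 0 ≤ C₂ * (‖cutoff φ z.im‖ * z.im ^ (1 / 2 - (r + 1 / 2) - 1)) := by positivity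
  have ht' : 0 < t ^ (-r) := by positivity
  constructor
  · calc _ ≤ ‖truncation f φ z‖ * (C₁ * z.im ^ r * t ^ (-r)) := by gcongr; exact h₁ z hz t ht
      _ = C₁ * (‖truncation f φ z‖ * z.im ^ r) * t ^ (-r) := by ring
      _ ≤ _ := by gcongr; linarith
  · have e : t ^ (1 - (r + 1 / 2) - 1 / 2) = t ^ (-r) := by congr 1; ring
    calc _ ≤ ‖cutoff φ z.im‖ * (C₂ * z.im ^ (1 / 2 - (r + 1 / 2) - 1) * t ^ (-r)) := by
          gcongr; rw [← e]; exact h₂ z t ht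
      _ = C₂ * (‖cutoff φ z.im‖ * z.im ^ (1 / 2 - (r + 1 / 2) - 1)) * t ^ (-r) := by ring
      _ ≤ _ := by gcongr; linarith

lemma integrableOn_truncation_mul_latticeTheta {t : ℝ} (ht : 0 < t) :
    IntegrableOn (fun z ↦ truncation f φ z * (latticeTheta z t : ℂ)) 𝒟 := by
  obtain ⟨g, hg, hb⟩ := h.exists_bound (r := max 2 (A - 1)) (by simp) (le_max_right _ _)
  refine Integrable.mono' (hg.mul_const (t ^ (-(max 2 (A - 1))))) (h.aestronglyMeasurable.restrict.mul
    (Complex.measurable_ofReal.comp (measurable_latticeTheta_left t)).aestronglyMeasurable) ?_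
  exact (ae_restrict_iff' measurableSet_fd).mpr (Eventually.of_forall fun z hz ↦ (hb z hz t ht).1)

lemma integrableOn_cutoff_mul_nonconstTheta {t : ℝ} (ht : 0 < t) :
    IntegrableOn (fun z ↦ cutoff φ z.im * (nonconstTheta z t : ℂ)) 𝒟 := by
  obtain ⟨g, hg, hb⟩ := h.exists_bound (r := max 2 (A - 1)) (by simp) (le_max_right _ _)
  refine Integrable.mono' (hg.mul_const (t ^ (-(max 2 (A - 1))))) ((measurable_cutoff_im h.continuousOn).aestronglyMeasurable.mul
    (Complex.measurable_ofReal.comp (measurable_nonconstTheta_left t)).aestronglyMeasurable) ?_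
  exact (ae_restrict_iff' measurableSet_fd).mpr (Eventually.of_forall fun z hz ↦ (hb z hz t ht).2)

lemma regularizedTheta_sub {t : ℝ} (ht : 0 < t) :
    regularizedTheta f φ t - regularizedMean f φ =
      ∫ z in 𝒟, (truncation f φ z * (latticeTheta z t : ℂ) + cutoff φ z.im * (nonconstTheta z t : ℂ)) := by
  have i₁ := h.integrableOn_truncation_mul_latticeTheta ht
  have i₂ := h.integrableOn_cutoff_mul_nonconstTheta ht
  have e : regularizedTheta f φ t = ∫ z in 𝒟, (truncation f φ z + (truncation f φ z * (latticeTheta z t : ℂ) +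
      cutoff φ z.im * (nonconstTheta z t : ℂ))) := by
    refine integral_congr_ae (Eventually.of_forall fun z ↦ ?_)
    push_cast
    ring
  have e' := integral_add h.integrableOn_truncation (i₁.add i₂)
  simp only [Pi.add_apply] at e'
  rw [e, e', regularizedMean, add_sub_cancel_left]

lemma exists_norm_regularizedTheta_sub_le {r : ℝ} (hr : 1 < r) (hrA : A - 1 ≤ r) :
    ∃ M, ∀ t, 0 < t → ‖regularizedTheta f φ t - regularizedMean f φ‖ ≤ M * t ^ (-r) := by
  obtain ⟨g, hg, hb⟩ := h.exists_bound hr hrA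
  refine ⟨2 * ∫ z in 𝒟, g z, fun t ht ↦ ?_⟩
  rw [h.regularizedTheta_sub ht, mul_assoc, ← integral_mul_const, ← integral_const_mul]
  refine norm_integral_le_of_norm_le ((hg.mul_const _).const_mul 2) ?_
  refine (ae_restrict_iff' measurableSet_fd).mpr (Eventually.of_forall fun z hz ↦ ?_)
  refine (norm_add_le _ _).trans ?_
  have := hb z hz t ht
  linarith

lemma locallyIntegrableOn_regularizedTheta : LocallyIntegrableOn (regularizedTheta f φ) (Ioi 0) := by
  have hm : AEStronglyMeasurable (regularizedTheta f φ) := by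
    have hj : AEStronglyMeasurable (fun p : ℝ × ℍ ↦ truncation f φ p.2 * ((1 + latticeTheta p.2 p.1 : ℝ) : ℂ) +
        cutoff φ p.2.im * (nonconstTheta p.2 p.1 : ℂ)) ((volume : Measure ℝ).prod (volume.restrict 𝒟)) := by
      refine AEStronglyMeasurable.add ?_ ?_
      · refine AEStronglyMeasurable.mul h.aestronglyMeasurable.restrict.comp_snd (Measurable.aestronglyMeasurable ?_)
        exact Complex.measurable_ofReal.comp (measurable_const.add
          (measurable_latticeTheta.comp (measurable_snd.prodMk measurable_fst)))
      · refine Measurable.aestronglyMeasurable ?_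
        exact ((measurable_cutoff_im h.continuousOn).comp measurable_snd).mul
          (Complex.measurable_ofReal.comp (measurable_nonconstTheta.comp (measurable_snd.prodMk measurable_fst)))
    exact hj.integral_prod_right'
  obtain ⟨M, hM⟩ := h.exists_norm_regularizedTheta_sub_le (r := max 2 (A - 1)) (by simp) (le_max_right _ _)
  rw [locallyIntegrableOn_iff isOpen_Ioi.isLocallyClosed]
  intro k hk hkc
  have hc : IntegrableOn (fun t : ℝ ↦ ‖regularizedMean f φ‖ + M * t ^ (-(max 2 (A - 1)))) k := by
    refine ContinuousOn.integrableOn_compact hkc (continuousOn_const.add (ContinuousOn.mul continuousOn_const ?_))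
    exact fun u hu ↦ (Real.continuousAt_rpow_const _ _ (Or.inl (hk hu).ne')).continuousWithinAt
  refine hc.mono' hm.restrict ?_
  refine (ae_restrict_iff' hkc.measurableSet).mpr (Eventually.of_forall fun t ht ↦ ?_)
  have := hM t (hk ht)
  have h3 := norm_le_norm_add_norm_sub' (regularizedTheta f φ t) (regularizedMean f φ)
  linarith

lemma regularizedTheta_isBigO (r : ℝ) :
    (fun t ↦ regularizedTheta f φ t - regularizedMean f φ) =O[atTop] fun t : ℝ ↦ t ^ r := by
  obtain ⟨M, hM⟩ := h.exists_norm_regularizedTheta_sub_le (r := max (max 2 (A - 1)) (-r))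
    (lt_max_of_lt_left (lt_max_of_lt_left (by norm_num))) ((le_max_right _ _).trans (le_max_left _ _))
  have hM0 : 0 ≤ M := by simpa using (norm_nonneg _).trans (hM 1 one_pos)
  refine Asymptotics.IsBigO.of_bound M ?_
  filter_upwards [eventually_ge_atTop 1] with t ht
  have ht0 : 0 < t := by linarith
  rw [Real.norm_of_nonneg (by positivity)]
  refine (hM t ht0).trans ?_
  refine mul_le_mul_of_nonneg_left (Real.rpow_le_rpow_of_exponent_le ht ?_) hM0
  linarith [le_max_right (max 2 (A - 1)) (-r)]

end GrowsLike

/-- The functional equation of `regularizedTheta`. -/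
noncomputable def thetaPair {f : ℍ → ℂ} {φ : ℝ → ℂ} {C A : ℝ} (h : GrowsLike f φ C A) : WeakFEPair ℂ where
  f := regularizedTheta f φ
  g := regularizedTheta f φ
  k := 1
  ε := 1
  f₀ := regularizedMean f φ
  g₀ := regularizedMean f φ
  hf_int := h.locallyIntegrableOn_regularizedTheta
  hg_int := h.locallyIntegrableOn_regularizedTheta
  hk := one_pos
  hε := one_ne_zero
  h_feq x hx := by
    rw [one_div, regularizedTheta_inv f φ hx, Real.rpow_one, one_mul, smul_eq_mul]
  hf_top := h.regularizedTheta_isBigO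
  hg_top := h.regularizedTheta_isBigO

/-! ### The Mellin transform of the regularised integral -/

namespace GrowsLike

variable {f : ℍ → ℂ} {φ : ℝ → ℂ} {C A : ℝ} (h : GrowsLike f φ C A)
include h

lemma integrableOn_strip_rpow {σ : ℝ} (h2 : 2 ≤ σ) (hA : A + 4 ≤ σ) :
    IntegrableOn (fun z ↦ truncation f φ z * ((z.im ^ σ : ℝ) : ℂ)) strip :=
  integrableOn_strip h.locallyIntegrable h.modular h.continuousOn h.isLittleO h.bound h2 hA

/-- Of the constant term subtracted from Θ, the part 2θ(t/y) is absorbed by unfolding; the part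
2√(y/t)θ(ty) remains as an integral over 𝒟. -/
lemma regularizedTheta_sub_eq {t : ℝ} (ht : 0 < t) :
    regularizedTheta f φ t - regularizedMean f φ =
      2 * (∫ z in strip, truncation f φ z * thetaTail (t * z.im⁻¹)) -
      2 * ∫ z in 𝒟, cutoff φ z.im * z.im *
        (((t * z.im : ℝ) : ℂ) ^ (-(1 / 2) : ℂ) * thetaTail (t * z.im)) := by
  have hσ := h.integrableOn_strip_rpow (le_max_left 2 (A + 4)) (le_max_right 2 (A + 4))
  rw [← integral_fd_eq_integral_strip h.modular (lt_of_lt_of_le (by norm_num) (le_max_left 2 (A + 4)))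
    hσ h.aestronglyMeasurable ht, h.regularizedTheta_sub ht, ← integral_const_mul]
  -- Writing √(y/t) = y·(ty)^(-1/2) makes the kernel a function of ty alone, as
  -- `hasMellin_integral_comp_mul` requires.
  have hsq (z : ℍ) : (z.im : ℂ) * ((t * z.im : ℝ) : ℂ) ^ (-(1 / 2) : ℂ) = (√(z.im / t) : ℂ) := by
    have hy := z.im_pos
    have e : (-(1 / 2) : ℂ) = ((-(1 / 2) : ℝ) : ℂ) := by push_cast; ring
    rw [e, ← Complex.ofReal_cpow (by positivity), ← Complex.ofReal_mul]
    congr 1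
    rw [Real.rpow_neg (by positivity), ← Real.sqrt_eq_rpow, Real.sqrt_mul' _ hy.le, Real.sqrt_div' _ ht.le]
    have h1 := Real.sqrt_pos.mpr hy
    have h2 := Real.sqrt_pos.mpr ht
    field_simp
    rw [Real.sq_sqrt hy.le]
  -- The exponent must exceed 1/2 for the theta bound and be at least A + 1/2 to compensate the
  -- growth y^A·√y.
  obtain ⟨C', hC', hb⟩ := exists_thetaTail_le (a := max 1 (A + 1 / 2)) (lt_of_lt_of_le (by norm_num) (le_max_left _ _))
  have i₂ : IntegrableOn (fun z : ℍ ↦ 2 * (cutoff φ z.im * z.im *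
        (((t * z.im : ℝ) : ℂ) ^ (-(1 / 2) : ℂ) * thetaTail (t * z.im)))) 𝒟 := by
    have i := (integrableOn_cutoff_mul_rpow h.continuousOn h.bound
      (a := 1 / 2 - max 1 (A + 1 / 2)) (by linarith [le_max_right 1 (A + 1 / 2)])).norm.const_mul
      (2 * C' * t ^ (-(1 / 2) - max 1 (A + 1 / 2)))
    refine Integrable.mono' i ?_ (Eventually.of_forall fun z ↦ ?_)
    · refine ((measurable_cutoff_im h.continuousOn).mul (Complex.measurable_ofReal.comp measurable_im)).mul ?_ |>.const_mul 2 |>.aestronglyMeasurable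
      exact ((Complex.measurable_ofReal.comp (measurable_const.mul measurable_im)).pow_const _).mul
        (measurable_thetaTail_comp (measurable_const.mul measurable_im))
    · have hy := z.im_pos
      rw [show (2 : ℂ) * (cutoff φ z.im * z.im * (((t * z.im : ℝ) : ℂ) ^ (-(1 / 2) : ℂ) * thetaTail (t * z.im))) =
        2 * (cutoff φ z.im * ((z.im * ((t * z.im : ℝ) : ℂ) ^ (-(1 / 2) : ℂ)) * thetaTail (t * z.im))) by ring, hsq]
      simp only [norm_mul, Complex.norm_real, Complex.norm_ofNat]
      rw [Real.norm_of_nonneg (thetaTail_nonneg _), Real.norm_of_nonneg (Real.sqrt_nonneg _),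
        Real.norm_of_nonneg (by positivity)]
      calc _ ≤ 2 * (‖cutoff φ z.im‖ * (√(z.im / t) * (C' * (t * z.im) ^ (-(max 1 (A + 1 / 2)))))) := by
            gcongr; exact hb _ (by positivity)
        _ = _ := by
            rw [Real.sqrt_eq_rpow, Real.div_rpow hy.le ht.le, Real.mul_rpow ht.le hy.le,
              sub_eq_add_neg (1 / 2 : ℝ), Real.rpow_add hy, sub_eq_add_neg (-(1 / 2) : ℝ), Real.rpow_add ht,
              Real.rpow_neg ht.le (1 / 2)]
            ring
  have i₁ := (h.integrableOn_truncation_mul_latticeTheta ht).add (h.integrableOn_cutoff_mul_nonconstTheta ht)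
  have key (z : ℍ) : truncation f φ z * (latticeTheta z t : ℂ) + cutoff φ z.im * (nonconstTheta z t : ℂ) +
      2 * (cutoff φ z.im * z.im * (((t * z.im : ℝ) : ℂ) ^ (-(1 / 2) : ℂ) * thetaTail (t * z.im))) =
      f z * latticeTheta z t - cutoff φ z.im * (2 * thetaTail (t * z.im⁻¹)) := by
    rw [show (2 : ℂ) * (cutoff φ z.im * z.im * (((t * z.im : ℝ) : ℂ) ^ (-(1 / 2) : ℂ) * thetaTail (t * z.im))) =
        2 * (cutoff φ z.im * ((z.im * ((t * z.im : ℝ) : ℂ) ^ (-(1 / 2) : ℂ)) * thetaTail (t * z.im))) by ring, hsq,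
      truncation, nonconstTheta, ← div_eq_mul_inv]
    push_cast
    ring
  rw [eq_sub_iff_add_eq]
  have := integral_add i₁ i₂
  simp only [Pi.add_apply] at this
  rw [← this]
  exact integral_congr_ae (Eventually.of_forall fun z ↦ key z)

/-- The Mellin transform of `regularizedTheta`, in the domain of absolute convergence. -/
lemma half_Λ_eq {s : ℂ} (h2 : 2 ≤ s.re) (hA : A + 4 ≤ s.re) :
    (thetaPair h).Λ s / 2 =
      completedRiemannZeta (2 * s) * (∫ z in strip, truncation f φ z * (z.im : ℂ) ^ s) -
      completedRiemannZeta (2 * s - 1) * ∫ z in 𝒟, cutoff φ z.im * (z.im : ℂ) ^ (1 - s) := by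
  have hMel := (thetaPair h).hasMellin (s := s) (show (1 : ℝ) < s.re by linarith)
  have hnorm (z : ℍ) (w : ℂ) : ‖(z.im : ℂ) ^ w‖ = z.im ^ w.re :=
    Complex.norm_cpow_eq_rpow_re_of_pos z.im_pos w
  have hcpow (w : ℂ) : Measurable fun z : ℍ ↦ (z.im : ℂ) ^ w :=
    (Complex.measurable_ofReal.comp measurable_im).pow_const w
  have e₁ (z : ℍ) : ((z.im⁻¹ : ℝ) : ℂ) ^ (-s) = (z.im : ℂ) ^ s := by
    rw [Complex.ofReal_inv, Complex.inv_cpow _ _ (by rw [Complex.arg_ofReal_of_nonneg z.im_pos.le]; exact Real.pi_pos.ne),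
      Complex.cpow_neg, inv_inv]
  have e₂ (z : ℍ) : (z.im : ℂ) * (z.im : ℂ) ^ (-s) = (z.im : ℂ) ^ (1 - s) := by
    rw [sub_eq_add_neg, Complex.cpow_add _ _ (by exact_mod_cast z.im_pos.ne'), Complex.cpow_one]
  have i₁ : IntegrableOn (fun z ↦ truncation f φ z * ((z.im⁻¹ : ℝ) : ℂ) ^ (-s)) strip := by
    simp_rw [e₁]
    refine Integrable.mono' (h.integrableOn_strip_rpow h2 hA).norm
      (h.aestronglyMeasurable.restrict.mul (hcpow s).aestronglyMeasurable) (Eventually.of_forall fun z ↦ ?_)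
    have hy := z.im_pos
    rw [norm_mul, norm_mul, hnorm, Complex.norm_real, Real.norm_of_nonneg (by positivity)]
  have i₂ : IntegrableOn (fun z : ℍ ↦ (cutoff φ z.im * z.im) * (z.im : ℂ) ^ (-s)) 𝒟 := by
    simp_rw [mul_assoc, e₂]
    refine Integrable.mono' (integrableOn_cutoff_mul_rpow h.continuousOn h.bound (a := 1 - s.re) (by linarith)).norm
      ((measurable_cutoff_im h.continuousOn).mul (hcpow _)).aestronglyMeasurable (Eventually.of_forall fun z ↦ ?_)
    have hy := z.im_pos
    rw [norm_mul, norm_mul, hnorm, Complex.norm_real, Real.norm_of_nonneg (by positivity)]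
    simp
  have m₁ := hasMellin_integral_comp_mul (μ := volume.restrict strip) (B := truncation f φ) (w := fun z ↦ z.im⁻¹)
    (κ := fun t ↦ (thetaTail t : ℂ)) h.aestronglyMeasurable.restrict measurable_im.inv
    (fun z ↦ inv_pos.mpr z.im_pos) (measurable_thetaTail_comp measurable_id)
    (hasMellin_thetaTail (s := s) (by linarith)) i₁
  have m₂ := hasMellin_integral_comp_mul (μ := volume.restrict 𝒟) (B := fun z ↦ cutoff φ z.im * z.im) (w := fun z ↦ z.im)
    (κ := fun t ↦ (t : ℂ) ^ (-(1 / 2) : ℂ) * (thetaTail t : ℂ))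
    ((measurable_cutoff_im h.continuousOn).mul (Complex.measurable_ofReal.comp measurable_im)).aestronglyMeasurable
    measurable_im (fun z ↦ z.im_pos)
    ((Complex.measurable_ofReal.pow_const _).mul (measurable_thetaTail_comp measurable_id))
    (hasMellin_inv_sqrt_mul_thetaTail (s := s) (by linarith)) i₂
  have m := hasMellin_sub (hasMellin_const_smul m₁.1 (2 : ℂ)).1 (hasMellin_const_smul m₂.1 (2 : ℂ)).1
  have e : mellin (fun t ↦ (thetaPair h).f t - (thetaPair h).f₀) s = _ :=
    (setIntegral_congr_fun measurableSet_Ioi fun t ht ↦ by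
      simp only [thetaPair, smul_eq_mul]
      rw [h.regularizedTheta_sub_eq ht]
      ).trans m.2
  rw [hMel.2, (hasMellin_const_smul m₁.1 (2 : ℂ)).2, (hasMellin_const_smul m₂.1 (2 : ℂ)).2, m₁.2, m₂.2] at e
  rw [e]
  simp_rw [mul_assoc, e₁, e₂, smul_eq_mul]
  ring

end GrowsLike

/-! ### From integrals on ℍ to integrals in y -/

lemma restrict_imMeasure {s : Set ℝ} (hs : MeasurableSet s) (hs0 : s ⊆ Ioi 0) :
    imMeasure.restrict s = (volume.restrict s).withDensity fun y ↦ ((1 / ‖y‖₊ ^ 2 : NNReal) : ℝ≥0∞) := by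
  rw [imMeasure, restrict_withDensity hs, Measure.restrict_restrict hs, inter_eq_left.mpr hs0]

lemma imDensity_smul {y : ℝ} (hy : 0 < y) (c : ℂ) : (1 / ‖y‖₊ ^ 2 : NNReal) • c = (y : ℂ) ^ (-2 : ℂ) * c := by
  rw [NNReal.smul_def]
  simp only [one_div, NNReal.coe_inv, NNReal.coe_pow, coe_nnnorm, Complex.real_smul]
  rw [Real.norm_of_nonneg hy.le, Complex.cpow_neg]
  norm_cast

lemma setIntegral_imMeasure {s : Set ℝ} (hs : MeasurableSet s) (hs0 : s ⊆ Ioi 0) (g : ℝ → ℂ) :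
    ∫ y in s, g y ∂imMeasure = ∫ y in s, (y : ℂ) ^ (-2 : ℂ) * g y := by
  rw [restrict_imMeasure hs hs0, integral_withDensity_eq_integral_smul (f := fun y : ℝ ↦ (1 / ‖y‖₊ ^ 2 : NNReal)) (by fun_prop)]
  exact setIntegral_congr_fun hs fun y hy ↦ imDensity_smul (hs0 hy) _

lemma restrict_Ioi_imMeasure : imMeasure.restrict (Ioi 0) = imMeasure := by
  rw [restrict_imMeasure measurableSet_Ioi subset_rfl, imMeasure]

lemma integrable_imMeasure_iff (g : ℝ → ℂ) :
    Integrable g imMeasure ↔ IntegrableOn (fun y : ℝ ↦ (y : ℂ) ^ (-2 : ℂ) * g y) (Ioi 0) := by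
  rw [imMeasure, integrable_withDensity_iff_integrable_smul (f := fun y : ℝ ↦ (1 / ‖y‖₊ ^ 2 : NNReal)) (by fun_prop)]
  exact integrableOn_congr_fun (fun y hy ↦ imDensity_smul hy _) measurableSet_Ioi

lemma ofComplex_im_re (z : ℍ) : UpperHalfPlane.ofComplex (z.re + z.im * Complex.I) = z := by
  have h : (z.re + z.im * Complex.I : ℂ) = z := Complex.re_add_im z
  rw [h, UpperHalfPlane.ofComplex_apply]

/-- The Mellin transform of the constant term as an integral over the strip. -/
lemma integral_strip_mul_cpow {f : ℍ → ℂ} {φ : ℝ → ℂ} {s : ℂ}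
    (hint : IntegrableOn (fun z ↦ truncation f φ z * (z.im : ℂ) ^ s) strip) :
    IntegrableOn (rankinSelbergIntegrand f (cutoff φ) s) (Ioi 0) ∧
    ∫ z in strip, truncation f φ z * (z.im : ℂ) ^ s =
      ∫ y in Ioi (0 : ℝ), rankinSelbergIntegrand f (cutoff φ) s y := by
  set F : ℝ × ℝ → ℂ := fun p ↦
    (f (UpperHalfPlane.ofComplex (p.2 + p.1 * Complex.I)) - cutoff φ p.1) * (p.1 : ℂ) ^ s with hF
  have hFz : (fun z ↦ truncation f φ z * (z.im : ℂ) ^ s) = F ∘ imRe := by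
    funext z
    simp only [hF, Function.comp_apply, imRe, truncation, ofComplex_im_re]
  have hstrip : strip = imRe ⁻¹' (univ ×ˢ Ioc 0 1) := by
    ext z; simp [strip, imRe]
  have hmp := measurePreserving_imRe.restrict_preimage_emb measurableEmbedding_imRe (univ ×ˢ Ioc 0 1)
  rw [← hstrip, ← Measure.prod_restrict, Measure.restrict_univ] at hmp
  rw [hFz] at hint
  have hFi : Integrable F (imMeasure.prod (volume.restrict (Ioc 0 1))) :=
    (hmp.integrable_comp_emb measurableEmbedding_imRe).mp hint
  have hpos : ∀ᵐ y ∂imMeasure, 0 < y := by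
    rw [← restrict_Ioi_imMeasure]
    exact ae_restrict_mem measurableSet_Ioi
  have hinner : ∀ᵐ y ∂imMeasure, ∫ x in Ioc (0 : ℝ) 1, F (y, x) =
      (y : ℂ) ^ s * (constantTerm f y - cutoff φ y) := by
    filter_upwards [hFi.prod_right_ae, hpos] with y hy hy0
    have hne : (y : ℂ) ^ s ≠ 0 := by
      rw [Complex.cpow_ne_zero_iff]; left; exact_mod_cast hy0.ne'
    -- For almost every y the slice of F is integrable in x; dividing by y^s gives integrability of
    -- f on the slice, needed to split the integral of the difference.
    have hi : Integrable (fun x : ℝ ↦ f (UpperHalfPlane.ofComplex (x + y * Complex.I))) (volume.restrict (Ioc 0 1)) := by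
      refine ((hy.mul_const ((y : ℂ) ^ s)⁻¹).add (integrable_const (cutoff φ y))).congr
        (Eventually.of_forall fun x ↦ ?_)
      simp only [hF, Pi.add_apply]
      rw [mul_assoc, mul_inv_cancel₀ hne]
      ring
    simp only [hF]
    rw [integral_mul_const, integral_sub hi (integrable_const _), constantTerm,
      intervalIntegral.integral_of_le zero_le_one]
    simp
    ring
  have hcomb : ∀ y ∈ Ioi (0 : ℝ), (y : ℂ) ^ (-2 : ℂ) * ((y : ℂ) ^ s * (constantTerm f y - cutoff φ y)) =
      rankinSelbergIntegrand f (cutoff φ) s y := by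
    intro y hy
    rw [rankinSelbergIntegrand, ← mul_assoc, ← Complex.cpow_add _ _ (by exact_mod_cast (ne_of_gt hy))]
    congr 2
    ring
  constructor
  · have h1 := hFi.integral_prod_left.congr hinner
    rw [integrable_imMeasure_iff] at h1
    exact (integrableOn_congr_fun hcomb measurableSet_Ioi).mp h1
  · rw [hFz, show ∫ z in strip, (F ∘ imRe) z = _ from hmp.integral_comp measurableEmbedding_imRe F,
      integral_prod _ hFi, integral_congr_ae hinner, ← restrict_Ioi_imMeasure,
      setIntegral_imMeasure measurableSet_Ioi subset_rfl]
    exact setIntegral_congr_fun measurableSet_Ioi hcomb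

/-- Above height 1 the condition |z| ≥ 1 is automatic, so 𝒟 is a half-strip of width 1 and the
x-integral in `integral_fd_cutoff` equals 1. -/
lemma fd_inter_one_lt_im : (𝒟 : Set ℍ) ∩ {z | 1 < z.im} = imRe ⁻¹' (Ioi 1 ×ˢ Icc (-1 / 2) (1 / 2)) := by
  ext z
  simp only [mem_inter_iff, mem_ofPred_eq, imRe, mem_preimage, mem_prod, mem_Ioi, mem_Icc]
  constructor
  · rintro ⟨h1, h2⟩
    have := abs_le.mp h1.2
    exact ⟨h2, by linarith, this.2⟩
  · rintro ⟨h2, h3, h4⟩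
    refine ⟨⟨?_, abs_le.mpr ⟨by linarith, h4⟩⟩, h2⟩
    rw [Complex.normSq_apply]
    have : (z : ℂ).im = z.im := rfl
    nlinarith [mul_self_nonneg (z : ℂ).re]

lemma integral_fd_cutoff (φ : ℝ → ℂ) (s : ℂ) :
    ∫ z in 𝒟, cutoff φ z.im * (z.im : ℂ) ^ (1 - s) = ∫ y in Ioi (1 : ℝ), (y : ℂ) ^ (-1 - s) * φ y := by
  have h1 : (fun z : ℍ ↦ cutoff φ z.im * (z.im : ℂ) ^ (1 - s)) =
      {z : ℍ | 1 < z.im}.indicator fun z ↦ φ z.im * (z.im : ℂ) ^ (1 - s) := by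
    funext z
    simp only [cutoff, indicator, mem_ofPred_eq]
    split_ifs <;> simp
  have h2 := measurePreserving_imRe.setIntegral_preimage_emb measurableEmbedding_imRe
    (fun p ↦ (φ p.1 * (p.1 : ℂ) ^ (1 - s)) * (1 : ℂ)) (Ioi 1 ×ˢ Icc (-1 / 2) (1 / 2))
  rw [← Measure.prod_restrict, integral_prod_mul (fun y : ℝ ↦ φ y * (y : ℂ) ^ (1 - s)) (fun _ ↦ (1 : ℂ)),
    setIntegral_imMeasure measurableSet_Ioi (Ioi_subset_Ioi zero_le_one)] at h2
  rw [h1, setIntegral_indicator (measurableSet_lt measurable_const measurable_im), fd_inter_one_lt_im]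
  simp only [mul_one] at h2
  rw [show (∫ z in imRe ⁻¹' (Ioi 1 ×ˢ Icc (-1 / 2) (1 / 2)), φ z.im * (z.im : ℂ) ^ (1 - s)) = _ from h2]
  have h3 : ∫ _ in Icc (-1 / 2 : ℝ) (1 / 2), (1 : ℂ) = 1 := by
    simp; norm_num
  rw [h3, mul_one]
  refine setIntegral_congr_fun measurableSet_Ioi fun y hy ↦ ?_
  have hy : 1 < y := hy
  have hy0 : (y : ℂ) ≠ 0 := by exact_mod_cast (by linarith : y ≠ 0)
  rw [show -1 - s = -2 + (1 - s) by ring, Complex.cpow_add _ _ hy0]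
  ring

/-! ### Explicit integrals of the growing part -/

lemma integral_pow_mul_exp_neg {w : ℂ} (hw : 0 < w.re) (n : ℕ) :
    ∫ u in Ioi (0 : ℝ), (u : ℂ) ^ n * Complex.exp (-(w * u)) = n.factorial / w ^ (n + 1) := by
  have hw0 : w ≠ 0 := fun h ↦ by simp [h] at hw
  have hnorm (k : ℕ) {u : ℝ} (hu : 0 < u) : ‖(u : ℂ) ^ k * Complex.exp (-(w * u))‖ =
      u ^ (k : ℝ) * Real.exp (-w.re * u) := by
    rw [norm_mul, norm_pow, Complex.norm_real, Real.norm_of_nonneg hu.le, Complex.norm_exp, Real.rpow_natCast]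
    simp
  have hint (k : ℕ) : IntegrableOn (fun u : ℝ ↦ (u : ℂ) ^ k * Complex.exp (-(w * u))) (Ioi 0) := by
    have h := integrableOn_rpow_mul_exp_neg_mul_rpow (p := 1) (s := k) (b := w.re)
      (by have : (0 : ℝ) ≤ k := Nat.cast_nonneg k
          linarith) one_pos hw
    refine Integrable.mono' h (Continuous.aestronglyMeasurable (by fun_prop)) ?_
    refine (ae_restrict_iff' measurableSet_Ioi).mpr (Eventually.of_forall fun u hu ↦ ?_)
    rw [hnorm k hu, Real.rpow_one]
  have hlim (k : ℕ) : Tendsto (fun u : ℝ ↦ (u : ℂ) ^ k * Complex.exp (-(w * u))) atTop (𝓝 0) := by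
    rw [tendsto_zero_iff_norm_tendsto_zero]
    refine (tendsto_rpow_mul_exp_neg_mul_atTop_nhds_zero k w.re hw).congr' ?_
    filter_upwards [eventually_gt_atTop 0] with u hu
    exact (hnorm k hu).symm
  have hexp (u : ℝ) : HasDerivAt (fun u : ℝ ↦ Complex.exp (-(w * u))) (-w * Complex.exp (-(w * u))) u := by
    have h1 : HasDerivAt (fun u : ℝ ↦ -(w * (u : ℂ))) (-w) u := by
      have h0 : HasDerivAt (fun u : ℝ ↦ w * (u : ℂ)) w u := by
        simpa using (Complex.ofRealCLM.hasDerivAt (x := u)).const_mul w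
      exact h0.fun_neg
    simpa [mul_comm] using h1.cexp
  induction n with
  | zero =>
    have hd (u : ℝ) : HasDerivAt (fun u : ℝ ↦ -w⁻¹ * Complex.exp (-(w * u))) ((u : ℂ) ^ 0 * Complex.exp (-(w * u))) u := by
      have e : (u : ℂ) ^ 0 * Complex.exp (-(w * u)) = -w⁻¹ * (-w * Complex.exp (-(w * u))) := by
        rw [pow_zero]
        field_simp
      rw [e]
      exact (hexp u).const_mul (-w⁻¹)
    have h0 : Tendsto (fun u : ℝ ↦ -w⁻¹ * Complex.exp (-(w * u))) atTop (𝓝 0) := by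
      simpa using (hlim 0).const_mul (-w⁻¹)
    rw [integral_Ioi_of_hasDerivAt_of_tendsto (hd 0).continuousAt.continuousWithinAt (fun u _ ↦ hd u) (hint 0) h0]
    simp
  | succ k ih =>
    have hd (u : ℝ) : HasDerivAt (fun u : ℝ ↦ (u : ℂ) ^ (k + 1) * Complex.exp (-(w * u)))
        ((k + 1) * ((u : ℂ) ^ k * Complex.exp (-(w * u))) - w * ((u : ℂ) ^ (k + 1) * Complex.exp (-(w * u)))) u := by
      have h1 : HasDerivAt (fun u : ℝ ↦ (u : ℂ) ^ (k + 1)) ((k + 1) * (u : ℂ) ^ k) u := by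
        have h0 : HasDerivAt (fun u : ℝ ↦ (u : ℂ)) 1 u := Complex.ofRealCLM.hasDerivAt
        simpa using h0.fun_pow (k + 1)
      have e : (k + 1) * ((u : ℂ) ^ k * Complex.exp (-(w * u))) - w * ((u : ℂ) ^ (k + 1) * Complex.exp (-(w * u))) =
          (k + 1) * (u : ℂ) ^ k * Complex.exp (-(w * u)) +
            (u : ℂ) ^ (k + 1) * (-w * Complex.exp (-(w * u))) := by ring
      rw [e]
      exact h1.fun_mul (hexp u)
    have h := integral_Ioi_of_hasDerivAt_of_tendsto (hd 0).continuousAt.continuousWithinAt (fun u _ ↦ hd u)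
      (((hint k).const_mul _).sub ((hint (k + 1)).const_mul _)) (hlim (k + 1))
    rw [integral_sub ((hint k).const_mul _) ((hint (k + 1)).const_mul _), integral_const_mul, integral_const_mul, ih] at h
    simp only [Complex.ofReal_zero, ne_eq, Nat.add_eq_zero_iff, one_ne_zero, and_false, not_false_eq_true,
      zero_pow, zero_mul, sub_zero] at h
    have h' := (sub_eq_zero.mp h).symm
    rw [eq_div_iff (pow_ne_zero _ hw0), pow_succ, mul_comm (w ^ (k + 1)), ← mul_assoc, mul_comm _ w, h',
      mul_assoc, div_mul_cancel₀ _ (pow_ne_zero _ hw0), Nat.factorial_succ]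
    push_cast
    ring

lemma cpow_exp (u : ℝ) (w : ℂ) : ((Real.exp u : ℝ) : ℂ) ^ w = Complex.exp (u * w) := by
  rw [Complex.cpow_def_of_ne_zero (by exact_mod_cast (Real.exp_pos u).ne'), ← Complex.ofReal_log (Real.exp_pos u).le,
    Real.log_exp]

/-- The integral of `y ^ (-w - 1) log ^ n y` over `(1, ∞)`. -/
lemma integral_Ioi_cpow_mul_log_pow {w : ℂ} (hw : 0 < w.re) (n : ℕ) :
    IntegrableOn (fun y : ℝ ↦ (y : ℂ) ^ (-w - 1) * (Real.log y : ℂ) ^ n) (Ioi 1) ∧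
    ∫ y in Ioi (1 : ℝ), (y : ℂ) ^ (-w - 1) * (Real.log y : ℂ) ^ n = n.factorial / w ^ (n + 1) := by
  have hw0 : w ≠ 0 := fun h ↦ by simp [h] at hw
  have himg : Real.exp '' Ioi 0 = Ioi 1 := by
    ext y
    constructor
    · rintro ⟨u, hu, rfl⟩; exact Real.one_lt_exp_iff.mpr hu
    · intro hy
      exact ⟨Real.log y, Real.log_pos hy, Real.exp_log (zero_lt_one.trans hy)⟩
  have h := integral_image_eq_integral_abs_deriv_smul (measurableSet_Ioi (a := (0 : ℝ)))
    (fun x _ ↦ (Real.hasDerivAt_exp x).hasDerivWithinAt) Real.exp_injective.injOn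
    (fun y : ℝ ↦ (y : ℂ) ^ (-w - 1) * (Real.log y : ℂ) ^ n)
  have heq : ∫ y in Ioi (1 : ℝ), (y : ℂ) ^ (-w - 1) * (Real.log y : ℂ) ^ n = n.factorial / w ^ (n + 1) := by
    rw [← himg, h, ← integral_pow_mul_exp_neg hw n]
    refine setIntegral_congr_fun measurableSet_Ioi fun u _ ↦ ?_
    rw [abs_of_pos (Real.exp_pos u), Real.log_exp, cpow_exp, Complex.real_smul, Complex.ofReal_exp, ← mul_assoc,
      ← Complex.exp_add, mul_comm]
    congr 2
    ring
  -- A nonintegrable function has Bochner integral 0, so a nonzero value proves integrability.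
  refine ⟨Integrable.of_integral_ne_zero ?_, heq⟩
  rw [heq]
  exact div_ne_zero (by exact_mod_cast n.factorial_ne_zero) (pow_ne_zero _ hw0)

/-- The integral of `y ^ (w - 1) log ^ n y` over `(0, 1)`. -/
lemma integral_Ioo_cpow_mul_log_pow {w : ℂ} (hw : 0 < w.re) (n : ℕ) :
    IntegrableOn (fun y : ℝ ↦ (y : ℂ) ^ (w - 1) * (Real.log y : ℂ) ^ n) (Ioo 0 1) ∧
    ∫ y in Ioo (0 : ℝ) 1, (y : ℂ) ^ (w - 1) * (Real.log y : ℂ) ^ n =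
      (-1) ^ n * (n.factorial / w ^ (n + 1)) := by
  have hw0 : w ≠ 0 := fun h ↦ by simp [h] at hw
  have himg : (fun u ↦ Real.exp (-u)) '' Ioi 0 = Ioo 0 1 := by
    ext y
    constructor
    · rintro ⟨u, hu, rfl⟩
      have hu : 0 < u := hu
      exact ⟨Real.exp_pos _, Real.exp_lt_one_iff.mpr (by linarith)⟩
    · intro hy
      exact ⟨-Real.log y, neg_pos.mpr (Real.log_neg hy.1 hy.2), by simp [Real.exp_log hy.1]⟩
  have h := integral_image_eq_integral_abs_deriv_smul (measurableSet_Ioi (a := (0 : ℝ)))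
    (f := fun u ↦ Real.exp (-u)) (f' := fun u ↦ Real.exp (-u) * -1)
    (fun x _ ↦ ((hasDerivAt_neg x).exp).hasDerivWithinAt)
    (fun a _ b _ hab ↦ neg_injective (Real.exp_injective hab))
    (fun y : ℝ ↦ (y : ℂ) ^ (w - 1) * (Real.log y : ℂ) ^ n)
  have heq : ∫ y in Ioo (0 : ℝ) 1, (y : ℂ) ^ (w - 1) * (Real.log y : ℂ) ^ n =
      (-1) ^ n * (n.factorial / w ^ (n + 1)) := by
    rw [← himg, h, ← integral_pow_mul_exp_neg hw n, ← integral_const_mul]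
    refine setIntegral_congr_fun measurableSet_Ioi fun u _ ↦ ?_
    rw [abs_mul, abs_of_pos (Real.exp_pos (-u)), Real.log_exp, cpow_exp, Complex.real_smul, abs_neg, abs_one, mul_one,
      Complex.ofReal_exp, ← mul_assoc, ← Complex.exp_add, Complex.ofReal_neg, neg_pow (u : ℂ)]
    have : -(u : ℂ) + -u * (w - 1) = -(w * u) := by ring
    rw [this]
    ring
  refine ⟨Integrable.of_integral_ne_zero ?_, heq⟩
  rw [heq]
  exact mul_ne_zero (pow_ne_zero _ (by norm_num))
    (div_ne_zero (by exact_mod_cast n.factorial_ne_zero) (pow_ne_zero _ hw0))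

section growingPart

variable {l : ℕ} (c α : Fin l → ℂ) (n : Fin l → ℕ)

lemma continuousOn_growingPart : ContinuousOn (growingPart c α n) (Ioi 0) := by
  unfold growingPart
  refine continuousOn_finsetSum _ fun i _ ↦ ContinuousOn.mul (continuousOn_const.mul ?_) (ContinuousOn.pow ?_ _)
  · intro y hy
    exact (Complex.continuousAt_ofReal_cpow_const _ _ (Or.inr (ne_of_gt hy))).continuousWithinAt
  · intro y hy
    exact (Complex.continuous_ofReal.continuousAt.comp (Real.continuousAt_log (ne_of_gt hy))).continuousWithinAt

/-- The bound log y ≤ y is enough, and summing the exponents gives one power that dominates every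
term. -/
lemma norm_growingPart_le {y : ℝ} (hy : 1 < y) :
    ‖growingPart c α n y‖ ≤ (∑ i, ‖c i / ((n i).factorial : ℂ)‖) * y ^ (∑ i, (|(α i).re| + n i)) := by
  have hy0 : 0 < y := by linarith
  rw [growingPart, Finset.sum_mul]
  refine (norm_sum_le _ _).trans (Finset.sum_le_sum fun i _ ↦ ?_)
  rw [norm_mul, norm_mul, norm_pow, Complex.norm_real, Complex.norm_cpow_eq_rpow_re_of_pos hy0,
    Real.norm_of_nonneg (Real.log_nonneg hy.le), mul_assoc]
  refine mul_le_mul_of_nonneg_left ?_ (norm_nonneg _)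
  calc y ^ (α i).re * Real.log y ^ n i ≤ y ^ |(α i).re| * y ^ n i := by
        have h1 := Real.log_nonneg hy.le
        have h2 : Real.log y ≤ y := (Real.log_le_sub_one_of_pos hy0).trans (by linarith)
        have h3 := hy.le
        have h4 := le_abs_self (α i).re
        gcongr
    _ = y ^ (|(α i).re| + n i) := by rw [Real.rpow_add hy0, Real.rpow_natCast]
    _ ≤ _ := Real.rpow_le_rpow_of_exponent_le hy.le
        (Finset.single_le_sum (f := fun i ↦ |(α i).re| + (n i : ℝ)) (fun j _ ↦ by positivity) (Finset.mem_univ i))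

lemma integral_Ioi_growingPart {s : ℂ} (hs : ∀ i, (α i).re < s.re) :
    ∫ y in Ioi (1 : ℝ), (y : ℂ) ^ (-1 - s) * growingPart c α n y =
      ∑ i, c i / (s - α i) ^ (n i + 1) := by
  have hw i : 0 < (s - α i).re := by rw [Complex.sub_re]; linarith [hs i]
  have e : ∀ y ∈ Ioi (1 : ℝ), (y : ℂ) ^ (-1 - s) * growingPart c α n y =
      ∑ i, c i / ((n i).factorial : ℂ) * ((y : ℂ) ^ (-(s - α i) - 1) * (Real.log y : ℂ) ^ n i) := by
    intro y hy
    have hy0 : (y : ℂ) ≠ 0 := by exact_mod_cast (zero_lt_one.trans hy).ne'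
    rw [growingPart, Finset.mul_sum]
    refine Finset.sum_congr rfl fun i _ ↦ ?_
    rw [show -(s - α i) - 1 = (-1 - s) + α i by ring, Complex.cpow_add _ _ hy0]
    ring
  rw [setIntegral_congr_fun measurableSet_Ioi e, integral_finsetSum]
  · refine Finset.sum_congr rfl fun i _ ↦ ?_
    rw [integral_const_mul, (integral_Ioi_cpow_mul_log_pow (hw i) (n i)).2]
    have : ((n i).factorial : ℂ) ≠ 0 := by exact_mod_cast (n i).factorial_ne_zero
    field_simp
  · exact fun i _ ↦ (integral_Ioi_cpow_mul_log_pow (hw i) (n i)).1.const_mul _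

/-- With w = s + α - 1 the logarithm on (0, 1) contributes (-1)^n/w^(n+1) = -1/(1 - s - α)^(n+1),
which explains the sign. -/
lemma integral_Ioc_growingPart {s : ℂ} (hs : ∀ i, (1 - α i).re < s.re) :
    IntegrableOn (fun y : ℝ ↦ (y : ℂ) ^ (s - 2) * growingPart c α n y) (Ioc 0 1) ∧
    ∫ y in Ioc (0 : ℝ) 1, (y : ℂ) ^ (s - 2) * growingPart c α n y =
      -∑ i, c i / (1 - s - α i) ^ (n i + 1) := by
  have hw i : 0 < (s + α i - 1).re := by
    have := hs i
    simp only [Complex.sub_re, Complex.add_re, Complex.one_re] at this ⊢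
    linarith
  have e : ∀ y ∈ Ioo (0 : ℝ) 1, (y : ℂ) ^ (s - 2) * growingPart c α n y =
      ∑ i, c i / ((n i).factorial : ℂ) * ((y : ℂ) ^ ((s + α i - 1) - 1) * (Real.log y : ℂ) ^ n i) := by
    intro y hy
    have hy0 : (y : ℂ) ≠ 0 := by exact_mod_cast hy.1.ne'
    rw [growingPart, Finset.mul_sum]
    refine Finset.sum_congr rfl fun i _ ↦ ?_
    rw [show s + α i - 1 - 1 = (s - 2) + α i by ring, Complex.cpow_add _ _ hy0]
    ring
  have hi (i : Fin l) := (integral_Ioo_cpow_mul_log_pow (hw i) (n i)).1.const_mul (c i / ((n i).factorial : ℂ))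
  rw [integrableOn_Ioc_iff_integrableOn_Ioo, integral_Ioc_eq_integral_Ioo]
  constructor
  · refine (integrableOn_congr_fun e measurableSet_Ioo).mpr ?_
    exact integrable_finsetSum _ fun i _ ↦ hi i
  · rw [setIntegral_congr_fun measurableSet_Ioo e, integral_finsetSum _ fun i _ ↦ hi i, ← Finset.sum_neg_distrib]
    refine Finset.sum_congr rfl fun i _ ↦ ?_
    rw [integral_const_mul, (integral_Ioo_cpow_mul_log_pow (hw i) (n i)).2]
    have h1 : ((n i).factorial : ℂ) ≠ 0 := by exact_mod_cast (n i).factorial_ne_zero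
    have h2 : s + α i - 1 ≠ 0 := fun h ↦ by have := hw i; simp [h] at this
    rw [show 1 - s - α i = -(s + α i - 1) by ring, neg_pow (s + α i - 1), pow_succ (-1 : ℂ)]
    have h3 : ((-1 : ℂ) ^ n i) * (-1) ^ n i = 1 := by rw [← mul_pow]; norm_num
    have h4 : ((-1 : ℂ) ^ n i) ≠ 0 := pow_ne_zero _ (by norm_num)
    field_simp
    linear_combination (c i) * h3

end growingPart

end RankinSelberg

/-! ### Assembly of the theorem -/

open RankinSelberg in
theorem theorem1 (f : ℍ → ℂ)
    (hf_int : MeasureTheory.LocallyIntegrable f MeasureTheory.volume)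
    (hf_mod : ∀ (γ : SL(2, ℤ)) (z : ℍ), f (γ • z) = f z)
    (l : ℕ) (c α : Fin l → ℂ) (n : Fin l → ℕ)
    (hf_growth : ∀ N : ℕ,
      (fun z : ℍ => f z - growingPart c α n z.im) =o[UpperHalfPlane.atImInfty]
        fun z : ℍ => z.im ^ (-(N : ℝ))) :
    ∃ R : ℂ → ℂ,
      Meromorphic R ∧
      (∃ σ₀ : ℝ, ∀ s : ℂ, σ₀ < s.re →
        MeasureTheory.IntegrableOn (rankinSelbergIntegrand f (growingPart c α n) s)
          (Set.Ioi 0) ∧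
        R s = rankinSelbergTransform f (growingPart c α n) s) ∧
      ∃ h : ℂ → ℂ, Differentiable ℂ h ∧
        ∀ s : ℂ, s ≠ 0 → s ≠ 1 / 2 → s ≠ 1 → (∀ i, s ≠ α i) → (∀ i, s ≠ 1 - α i) →
          R s = (∑ i, c i *
              (completedRiemannZeta (2 * s) / (1 - s - α i) ^ (n i + 1)
                + completedRiemannZeta (2 * s - 1) / (s - α i) ^ (n i + 1)))
            + h s / (s * (s - 1)) := by
  set A : ℝ := ∑ i, (|(α i).re| + n i) with hA
  have hG : GrowsLike f (growingPart c α n) (∑ i, ‖c i / ((n i).factorial : ℂ)‖) A :=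
    ⟨hf_int, hf_mod, continuousOn_growingPart c α n, hf_growth, fun y hy ↦ norm_growingPart_le c α n hy⟩
  set P := thetaPair hG with hP
  -- This is s(s - 1)Λ(s)/2: the two polar terms of Λ have the same constant, so after clearing
  -- denominators their linear parts cancel and only `P.f₀` remains.
  set H : ℂ → ℂ := fun s ↦ (s * (s - 1) * P.Λ₀ s + P.f₀) / 2 with hH
  have hHd : Differentiable ℂ H := by
    have := P.differentiable_Λ₀
    simp only [hH]
    fun_prop
  have hHΛ (s : ℂ) (h0 : s ≠ 0) (h1 : s ≠ 1) : H s / (s * (s - 1)) = P.Λ s / 2 := by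
    have h1' : s - 1 ≠ 0 := sub_ne_zero.mpr h1
    have h1'' : 1 - s ≠ 0 := sub_ne_zero.mpr h1.symm
    have hΛ : P.Λ s = P.Λ₀ s - (1 / s) * P.f₀ - (1 / (1 - s)) * P.f₀ := by
      have : P.Λ s = P.Λ₀ s - (1 / s) • P.f₀ - (P.ε / (P.k - s)) • P.g₀ := rfl
      rw [this]
      simp [hP, thetaPair]
    rw [hΛ, hH]
    simp only []
    field_simp
    ring
  have hA_le i : |(α i).re| ≤ A :=
    (le_add_of_nonneg_right (Nat.cast_nonneg (n i))).trans
      (Finset.single_le_sum (f := fun i ↦ |(α i).re| + (n i : ℝ)) (fun j _ ↦ by positivity) (Finset.mem_univ i))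
  have hA0 : 0 ≤ A := Finset.sum_nonneg fun i _ ↦ by positivity
  -- R is defined by the explicit formula at every point, so only meromorphy and agreement with R*
  -- for Re s > A + 4 are left; that bound comes from integrability on the strip.
  refine ⟨fun s ↦ (∑ i, c i *
              (completedRiemannZeta (2 * s) / (1 - s - α i) ^ (n i + 1)
                + completedRiemannZeta (2 * s - 1) / (s - α i) ^ (n i + 1)))
            + H s / (s * (s - 1)), ?_, ⟨A + 4, fun s hs ↦ ?_⟩, H, hHd, fun s _ _ _ _ _ ↦ rfl⟩
  · intro x
    have hH' : MeromorphicAt H x := (hHd.analyticAt x).meromorphicAt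
    have z₁ : MeromorphicAt (fun s ↦ completedRiemannZeta (2 * s)) x := by
      simp_rw [completedRiemannZeta_eq]
      have d : Differentiable ℂ fun s : ℂ ↦ completedRiemannZeta₀ (2 * s) :=
        differentiable_completedZeta₀.comp (by fun_prop)
      have := (d.analyticAt x).meromorphicAt
      fun_prop
    have z₂ : MeromorphicAt (fun s ↦ completedRiemannZeta (2 * s - 1)) x := by
      simp_rw [completedRiemannZeta_eq]
      have d : Differentiable ℂ fun s : ℂ ↦ completedRiemannZeta₀ (2 * s - 1) :=
        differentiable_completedZeta₀.comp (by fun_prop)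
      have := (d.analyticAt x).meromorphicAt
      fun_prop
    fun_prop
  · have hα i := abs_le.mp (hA_le i)
    have hint : MeasureTheory.IntegrableOn
        (fun z ↦ truncation f (growingPart c α n) z * (z.im : ℂ) ^ s) strip := by
      refine MeasureTheory.Integrable.mono' (hG.integrableOn_strip_rpow (σ := s.re) (by linarith) hs.le).norm
        (hG.aestronglyMeasurable.restrict.mul
          ((Complex.measurable_ofReal.comp measurable_im).pow_const s).aestronglyMeasurable)
        (Filter.Eventually.of_forall fun z ↦ ?_)
      have hy := z.im_pos
      rw [norm_mul, norm_mul, Complex.norm_real, Complex.norm_cpow_eq_rpow_re_of_pos hy,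
        Real.norm_of_nonneg (by positivity)]
    obtain ⟨i₁, e₁⟩ := integral_strip_mul_cpow hint
    obtain ⟨i₂, e₂⟩ := integral_Ioc_growingPart c α n (s := s) (fun i ↦ by
      rw [Complex.sub_re, Complex.one_re]; linarith [(hα i).1])
    have e₃ := integral_Ioi_growingPart c α n (s := s) (fun i ↦ by linarith [(hα i).2])
    -- Unfolding removes φ only for y > 1. The missing piece over (0, 1] gives the terms in 1 - s -
    -- α_i.
    have hsplit : rankinSelbergIntegrand f (growingPart c α n) s =
        fun y ↦ rankinSelbergIntegrand f (cutoff (growingPart c α n)) s y -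
          (Set.Iic 1).indicator (fun y : ℝ ↦ (y : ℂ) ^ (s - 2) * growingPart c α n y) y := by
      funext y
      simp only [rankinSelbergIntegrand, cutoff, Set.indicator, Set.mem_Iic]
      by_cases hy : 1 < y
      · rw [if_pos hy, if_neg (not_le.mpr hy), sub_zero]
      · rw [if_neg hy, if_pos (not_lt.mp hy)]; ring
    have i₃ : MeasureTheory.IntegrableOn
        ((Set.Iic 1).indicator (fun y : ℝ ↦ (y : ℂ) ^ (s - 2) * growingPart c α n y)) (Set.Ioi 0) := by
      rw [MeasureTheory.integrableOn_indicator_iff measurableSet_Iic, Set.inter_comm, Set.Ioi_inter_Iic]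
      exact i₂
    refine ⟨hsplit ▸ i₁.sub i₃, ?_⟩
    have hΛ := hG.half_Λ_eq (s := s) (by linarith) hs.le
    beta_reduce
    rw [hHΛ s (fun h ↦ by rw [h, Complex.zero_re] at hs; linarith)
      (fun h ↦ by rw [h, Complex.one_re] at hs; linarith), hΛ, e₁, integral_fd_cutoff, e₃,
      rankinSelbergTransform, hsplit, MeasureTheory.integral_sub i₁ i₃,
      MeasureTheory.setIntegral_indicator measurableSet_Iic, Set.Ioi_inter_Iic, e₂]
    simp_rw [mul_add, Finset.sum_add_distrib, mul_sub, mul_neg, Finset.mul_sum, ← mul_div_assoc]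
    simp_rw [mul_comm (c _)]
    ring
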